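/- **Theorem.** Let $N\ge 1$, let $\Omega\subset\mathbb R^N$ be a bounded open set (for instance a bounded smooth domain), and let $2<p<\kappa$. Let $\zeta\in C^1([0,\infty))$ with $\zeta(0)>0$ and $\zeta'\ge 0$. Let $f\in C(\mathbb R)$ satisfy $|f|\le g$ for some $C^1$ function $g$, and, with $F(s)=\int_0^s f(\tau)\,d\tau$, $$0\le \kappa F(s)\le s f(s)\qquad\text{for all } s\in\mathbb R .$$ Let $u_0\in L^\infty(\Omega)\cap W_0^{1,p}(\Omega)$, $u_0\not\equiv 0$, have nonpositive energy $$\mathbf E_p(u_0)=\frac1p\int_\Omega|\nabla u_0|^p\,dx-\zeta(0)\int_\Omega F(u_0)\,dx\le 0 .$$ For $0<T<\infty$, a *solution on $(0,T)$* is a weak solution $u$ of $$u_t-\operatorname{div}(|\nabla u|^{p-2}\nabla u)=\zeta(t)f(u)\ \text{ in }(0,T)\times\Omega,\qquad u=0\ \text{ on }(0,T)\times\partial\Omega,\qquad u(0,\cdot)=u_0,$$ in the class $u\in L^\infty((0,T)\times\Omega)\cap L^p((0,T);W_0^{1,p}(\Omega))$, $u_t\in L^2((0,T)\times\Omega)$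 (weak derivatives; the equation holds in the sense of distributions on $\Omega$ for almost every $t$). Then every solution blows up in finite time, in the following sense. There are constants $C>0$, depending only on $\Omega$ and $p$, such that $$\tfrac12\|v\|_{L^2(\Omega)}^2\le C\Big(\int_\Omega|\nabla v|^p\,dx\Big)^{2/p}\qquad\text{for all } v\in W_0^{1,p}(\Omega),$$ and 1. for each such $C$, if there is a solution on $(0,T)$, then $$T\le \frac{2p\,C^{p/2}\,\big(\tfrac12\|u_0\|_{L^2(\Omega)}^2\big)^{1-p/2}}{(p-2)(\kappa-p)};$$ in particular there is no global solution, and the maximal time of existence of any solution is finite and bounded by the right-hand side; 2. if $0<T<\infty$ and $u$ is a solution on $(0,T')$ for every $T'\in(0,T)$ but not on $(0,T)$, then $\|u\|_{L^\infty((0,t)\times\Omega)}\to\infty$ as $t\uparrow T$. -/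

import Mathlib

open MeasureTheory Set Filter Topology
open scoped ENNReal ContDiff

noncomputable section

namespace PLaplaceHeat

/-- `φ ∈ C_c^∞(U)`: a smooth function on the whole space whose support is a compact subset of `U`. -/
def IsTestFunction {X : Type*} [NormedAddCommGroup X] [NormedSpace ℝ X]
    (U : Set X) (φ : X → ℝ) : Prop :=
  ContDiff ℝ ∞ φ ∧ HasCompactSupport φ ∧ tsupport φ ⊆ U

/-- `v ∈ W_0^{1,p}(Ω)` with weak gradient `G`: the pair `(v, G)` lies in the closure in
`L^p(Ω) × L^p(Ω; ℝ^N)` of the pairs `(φ, ∇φ)`, `φ ∈ C_c^∞(Ω)`. -/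
def MemW0 {N : ℕ} (Ω : Set (EuclideanSpace ℝ (Fin N))) (p : ℝ)
    (v : EuclideanSpace ℝ (Fin N) → ℝ)
    (G : EuclideanSpace ℝ (Fin N) → EuclideanSpace ℝ (Fin N)) : Prop :=
  MemLp v (ENNReal.ofReal p) (volume.restrict Ω) ∧
  MemLp G (ENNReal.ofReal p) (volume.restrict Ω) ∧
  ∃ φ : ℕ → EuclideanSpace ℝ (Fin N) → ℝ,
    (∀ n, IsTestFunction Ω (φ n)) ∧
    Tendsto (fun n => eLpNorm (fun x => φ n x - v x) (ENNReal.ofReal p) (volume.restrict Ω))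
      atTop (𝓝 0) ∧
    Tendsto (fun n => eLpNorm (fun x => gradient (φ n) x - G x) (ENNReal.ofReal p)
      (volume.restrict Ω)) atTop (𝓝 0)

/-- The primitive `F(s) = ∫_0^s f(τ) dτ`. -/
def primitive (f : ℝ → ℝ) (s : ℝ) : ℝ := ∫ τ in (0 : ℝ)..s, f τ

/-- The energy `(1/p) ∫_Ω |∇v|^p - z ∫_Ω F(v)` of `v` with gradient `G`, where `z` is the value
of the coefficient `ζ` at the time considered. -/
def energy {N : ℕ} (Ω : Set (EuclideanSpace ℝ (Fin N))) (p z : ℝ) (f : ℝ → ℝ)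
    (v : EuclideanSpace ℝ (Fin N) → ℝ)
    (G : EuclideanSpace ℝ (Fin N) → EuclideanSpace ℝ (Fin N)) : ℝ :=
  (1 / p) * (∫ x in Ω, ‖G x‖ ^ p) - z * ∫ x in Ω, primitive f (v x)

/-- `u` is a weak solution on `(0,T) × Ω` of `u_t - Δ_p u = ζ(t) f(u)`, `u = 0` on `∂Ω`,
`u(0) = u₀`, in the class
`u ∈ L^∞((0,T) × Ω) ∩ L^p((0,T); W_0^{1,p}(Ω))`, `u_t ∈ L^2((0,T) × Ω)`.
Here `G = ∇u` is the weak space gradient and `w = u_t` the weak time derivative. -/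
structure IsWeakSolution {N : ℕ} (Ω : Set (EuclideanSpace ℝ (Fin N))) (p : ℝ) (ζ f : ℝ → ℝ)
    (u₀ : EuclideanSpace ℝ (Fin N) → ℝ) (T : ℝ)
    (u : ℝ → EuclideanSpace ℝ (Fin N) → ℝ)
    (G : ℝ → EuclideanSpace ℝ (Fin N) → EuclideanSpace ℝ (Fin N))
    (w : ℝ → EuclideanSpace ℝ (Fin N) → ℝ) : Prop where
  /-- `u ∈ L^∞((0,T) × Ω)` -/
  bounded : MemLp (Function.uncurry u) ∞ (volume.restrict (Ioo 0 T ×ˢ Ω))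
  /-- `∇u ∈ L^p((0,T) × Ω)` -/
  grad_memLp : MemLp (Function.uncurry G) (ENNReal.ofReal p) (volume.restrict (Ioo 0 T ×ˢ Ω))
  /-- `u(t) ∈ W_0^{1,p}(Ω)` with gradient `G(t)`, for almost every `t` -/
  memW0 : ∀ᵐ t ∂(volume.restrict (Ioo 0 T)), MemW0 Ω p (u t) (G t)
  /-- `u_t ∈ L^2((0,T) × Ω)` -/
  deriv_memLp : MemLp (Function.uncurry w) 2 (volume.restrict (Ioo 0 T ×ˢ Ω))
  /-- `w` is the weak time derivative of `u` and `u(0) = u₀`: integration by parts in time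
  against test functions that need not vanish at `t = 0`. -/
  deriv_initial : ∀ φ : ℝ × EuclideanSpace ℝ (Fin N) → ℝ, IsTestFunction (Iio T ×ˢ Ω) φ →
    (∫ z in Ioo 0 T ×ˢ Ω, u z.1 z.2 * deriv (fun s => φ (s, z.2)) z.1) +
      (∫ x in Ω, u₀ x * φ (0, x)) = - ∫ z in Ioo 0 T ×ˢ Ω, w z.1 z.2 * φ z
  /-- For almost every `t` the equation holds in the sense of distributions on `Ω`. -/
  equation : ∀ᵐ t ∂(volume.restrict (Ioo 0 T)),
    ∀ φ : EuclideanSpace ℝ (Fin N) → ℝ, IsTestFunction Ω φ →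
      (∫ x in Ω, w t x * φ x) +
        (∫ x in Ω, inner ℝ (‖G t x‖ ^ (p - 2) • G t x) (gradient φ x)) =
      ζ t * ∫ x in Ω, f (u t x) * φ x

/-- `C` is an admissible constant in the inequality
`(1/2) ‖v‖_2^2 ≤ C ‖∇v‖_p^2` on `W_0^{1,p}(Ω)`; it only involves `Ω` and `p`. -/
def PoincareConst {N : ℕ} (Ω : Set (EuclideanSpace ℝ (Fin N))) (p C : ℝ) : Prop :=
  0 < C ∧ ∀ (v : EuclideanSpace ℝ (Fin N) → ℝ)
    (G : EuclideanSpace ℝ (Fin N) → EuclideanSpace ℝ (Fin N)), MemW0 Ω p v G →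
      (1 / 2) * (∫ x in Ω, v x ^ 2) ≤ C * (∫ x in Ω, ‖G x‖ ^ p) ^ (2 / p)

/-- The upper bound `2 p C^{p/2} L(0)^{1 - p/2} / ((p-2)(κ-p))` for the blow-up time, with
`L(0) = (1/2) ‖u₀‖_2^2`. -/
def blowUpBound {N : ℕ} (Ω : Set (EuclideanSpace ℝ (Fin N))) (p κ C : ℝ)
    (u₀ : EuclideanSpace ℝ (Fin N) → ℝ) : ℝ :=
  2 * p * C ^ (p / 2) * ((1 / 2) * ∫ x in Ω, u₀ x ^ 2) ^ (1 - p / 2) / ((p - 2) * (κ - p))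

end PLaplaceHeat

end

noncomputable section

namespace PLaplaceHeat

/-! This is a concavity argument for $L(t)=\frac12\|u(t)\|_2^2$. Testing the equation with $u$ gives
$L'=\zeta\int u f(u)-\int|\nabla u|^p$ (`IsWeakSolution.exists_sq_evolution`). The energy does not
increase, so it stays nonpositive (`IsWeakSolution.energy_le`), that is $\frac1p\int|\nabla
u|^p\le\zeta\int F(u)$. With $\kappa F(s)\le sf(s)$ this yields $L'\ge\frac{\kappa-p}{p}\int|\nabla
u|^p$, and the Poincaré inequality turns the right side into a multiple of $L^{p/2}$. As $p/2>1$,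
integrating $L'L^{-p/2}$ bounds the time of existence (`mul_le_of_superlinear_growth`).

The hard point is the energy inequality. Formally one tests with $u_t$, but $u_t$ is only in $L^2$
and need not be an admissible test function. Instead, with $\Phi=\frac1p\int|\nabla u|^p$ and
$H=\zeta f(u)-u_t$, convexity gives $\Phi(r)-\Phi(s)\le\int H(r)(u(r)-u(s))$ for almost all $r,s$
(`dirichlet_sub_le`). Taking $s=r-\delta$, integrating in $r$ and dividing by $\delta$, the left
side telescopes, and the right side pairs $H$ with a backward Steklov average of $u_t$. The limit
$\delta\to0$ gives $\Phi(b)-\Phi(0)\le\iint H u_t$ (`ae_sub_le_integral_of_increment_le`). The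
nonlinear part of $H u_t$ is handled by the chain rule along the curves $t\mapsto u(t,x)$, which are
absolutely continuous after choosing a representative (`IsWeakSolution.exists_evolution`).

For the second claim, a sup norm that does not tend to infinity is bounded up to $T$, because it is
monotone in $t$. The two identities then bound $\iint|\nabla u|^p$ and $\iint u_t^2$ up to $T$, so
$u$ is a solution on $(0,T)$ (`isWeakSolution_of_bounded`). -/

theorem LipschitzOnWith.comp_absolutelyContinuousOnInterval {F U : ℝ → ℝ} {K : NNReal} {a b : ℝ}
    {s : Set ℝ} (hF : LipschitzOnWith K F s) (hU : AbsolutelyContinuousOnInterval U a b)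
    (hs : MapsTo U (uIcc a b) s) : AbsolutelyContinuousOnInterval (fun t => F (U t)) a b := by
  have h1 : Tendsto (fun E : ℕ × (ℕ → ℝ × ℝ) =>
      (K : ℝ) * ∑ i ∈ Finset.range E.1, dist (U (E.2 i).1) (U (E.2 i).2))
      (AbsolutelyContinuousOnInterval.totalLengthFilter ⊓
        𝓟 (AbsolutelyContinuousOnInterval.disjWithin a b)) (𝓝 0) := by
    simpa using Tendsto.const_mul (K : ℝ) hU
  refine squeeze_zero' (Eventually.of_forall fun E => Finset.sum_nonneg fun _ _ => dist_nonneg) ?_ h1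
  have h2 : ∀ᶠ E in (AbsolutelyContinuousOnInterval.totalLengthFilter ⊓
        𝓟 (AbsolutelyContinuousOnInterval.disjWithin a b)),
        E ∈ AbsolutelyContinuousOnInterval.disjWithin a b :=
    eventually_inf_principal.mpr (by simp)
  filter_upwards [h2] with E hE
  rw [Finset.mul_sum]
  refine Finset.sum_le_sum fun i hi => ?_
  exact hF.dist_le_mul _ (hs (hE.1 i hi).1) _ (hs (hE.1 i hi).2)

/-! ### Chain rules along absolutely continuous curves. -/

section Chain

variable {F f w : ℝ → ℝ} {b c : ℝ}

theorem absolutelyContinuousOnInterval_add_integral (hw : IntervalIntegrable w volume 0 b) :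
    AbsolutelyContinuousOnInterval (fun t => c + ∫ s in (0 : ℝ)..t, w s) 0 b := by
  have h1 : AbsolutelyContinuousOnInterval (fun _ : ℝ => c) 0 b :=
    (contDiff_const.contDiffOn).absolutelyContinuousOnInterval
  exact h1.add (hw.absolutelyContinuousOnInterval_intervalIntegral (by simp))

/-- The curve has compact range, and a $C^1$ function is Lipschitz on a compact interval containing
it. -/
theorem absolutelyContinuousOnInterval_comp_integral (hF : ∀ y, HasDerivAt F (f y) y)
    (hf : Continuous f) (hw : IntervalIntegrable w volume 0 b) :
    AbsolutelyContinuousOnInterval (fun t => F (c + ∫ s in (0 : ℝ)..t, w s)) 0 b := by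
  have hU := absolutelyContinuousOnInterval_add_integral (c := c) hw
  have hFd : ContDiff ℝ 1 F := by
    rw [contDiff_one_iff_deriv]
    refine ⟨fun y => (hF y).differentiableAt, ?_⟩
    rwa [show deriv F = f from funext fun y => (hF y).deriv]
  obtain ⟨M, hM⟩ := (isCompact_uIcc.image_of_continuousOn hU.continuousOn).isBounded.exists_norm_le
  obtain ⟨K, hK⟩ := (hFd.contDiffOn (s := Icc (-M) M)).exists_lipschitzOnWith (by decide)
    (convex_Icc _ _) isCompact_Icc
  refine LipschitzOnWith.comp_absolutelyContinuousOnInterval hK hU fun t ht => ?_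
  exact abs_le.1 (hM _ (mem_image_of_mem _ ht))

theorem ae_deriv_comp_integral (hF : ∀ y, HasDerivAt F (f y) y)
    (hw : IntervalIntegrable w volume 0 b) :
    ∀ᵐ t, t ∈ uIcc 0 b → deriv (fun t => F (c + ∫ s in (0 : ℝ)..t, w s)) t =
      f (c + ∫ s in (0 : ℝ)..t, w s) * w t := by
  filter_upwards [hw.ae_hasDerivAt_integral] with t ht htb
  have h1 := (ht htb 0 (by simp)).const_add c
  exact ((hF _).comp t h1).deriv

/-- Chain rule for a primitive of a continuous function along an absolutely continuous curve. -/
theorem integral_comp_mul_eq_sub (hF : ∀ y, HasDerivAt F (f y) y)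
    (hf : Continuous f) (hw : IntervalIntegrable w volume 0 b) :
    ∫ t in (0 : ℝ)..b, f (c + ∫ s in (0 : ℝ)..t, w s) * w t =
      F (c + ∫ s in (0 : ℝ)..b, w s) - F c := by
  have h := (absolutelyContinuousOnInterval_comp_integral (c := c) hF hf hw).integral_deriv_eq_sub
  simp only [intervalIntegral.integral_same, add_zero] at h
  rw [← h]
  refine intervalIntegral.integral_congr_ae ?_
  filter_upwards [ae_deriv_comp_integral (c := c) hF hw] with t ht htb
  exact (ht (uIoc_subset_uIcc htb)).symm

/-- Chain rule for a nonnegative primitive, with a nondecreasing weight. -/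
theorem integral_weight_comp_mul_le (hF : ∀ y, HasDerivAt F (f y) y) (hF0 : ∀ y, 0 ≤ F y)
    (hf : Continuous f) (hw : IntervalIntegrable w volume 0 b) (hb : 0 ≤ b)
    {ζ : ℝ → ℝ} (hζ : ContDiffOn ℝ 1 ζ (Ici 0)) (hζ' : ∀ t, 0 ≤ t → 0 ≤ derivWithin ζ (Ici 0) t) :
    ∫ t in (0 : ℝ)..b, ζ t * (f (c + ∫ s in (0 : ℝ)..t, w s) * w t) ≤
      ζ b * F (c + ∫ s in (0 : ℝ)..b, w s) - ζ 0 * F c := by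
  have hA := absolutelyContinuousOnInterval_comp_integral (c := c) hF hf hw
  have hZ : AbsolutelyContinuousOnInterval ζ 0 b :=
    (hζ.mono (by rw [uIcc_of_le hb]; exact Icc_subset_Ici_self)).absolutelyContinuousOnInterval
  have h := hZ.integral_mul_deriv_eq_deriv_mul hA
  simp only [intervalIntegral.integral_same, add_zero] at h
  have h1 : ∫ t in (0 : ℝ)..b, ζ t * (f (c + ∫ s in (0 : ℝ)..t, w s) * w t) =
      ∫ t in (0 : ℝ)..b, ζ t * deriv (fun t => F (c + ∫ s in (0 : ℝ)..t, w s)) t := by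
    refine intervalIntegral.integral_congr_ae ?_
    filter_upwards [ae_deriv_comp_integral (c := c) hF hw] with t ht htb
    rw [ht (uIoc_subset_uIcc htb)]
  -- After integration by parts the only leftover is $\int\zeta' F$, which is dropped because
  -- $\zeta'\ge0$ and $F\ge0$.
  rw [h1, h, sub_le_self_iff]
  refine intervalIntegral.integral_nonneg_of_ae_restrict hb ?_
  rw [Filter.EventuallyLE, ae_restrict_iff' measurableSet_Icc]
  -- At $t=0$ the two-sided `deriv ζ` is not controlled by the one-sided derivative, so this point
  -- is discarded.
  have h0 : ∀ᵐ t : ℝ, t ≠ 0 := by simp [ae_iff, measure_singleton]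
  filter_upwards [h0] with t ht0 ht
  have htp : 0 < t := lt_of_le_of_ne ht.1 (Ne.symm ht0)
  refine mul_nonneg ?_ (hF0 _)
  rw [← derivWithin_of_mem_nhds (Ici_mem_nhds htp)]
  exact hζ' t ht.1

end Chain

/-! ### Translations and Steklov averages in $L^2(\mathbb R)$. -/

section Translation

theorem measurePreserving_sub_const (η : ℝ) :
    MeasurePreserving (fun r : ℝ => r - η) volume volume :=
  measurePreserving_sub_right volume η

variable {g w : ℝ → ℝ}

/-- Translation is continuous in $L^2$, and the correlation is its inner product with a fixed
element. -/
theorem continuous_integral_mul_comp_sub (hg : MemLp g 2 volume) (hw : MemLp w 2 volume) :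
    Continuous fun η : ℝ => ∫ r, g r * w (r - η) := by
  let k : ℝ → C(ℝ, ℝ) := fun η => ⟨fun r => r - η, by fun_prop⟩
  have hk : Continuous k := by
    refine ContinuousMap.continuous_of_continuous_uncurry _ ?_
    exact continuous_snd.sub continuous_fst
  have h1 : Continuous fun η : ℝ =>
      Lp.compMeasurePreserving (k η) (measurePreserving_sub_const η) (hw.toLp w) :=
    (continuous_const (y := hw.toLp w)).compMeasurePreservingLp hk _ (by simp)
  have h2 := (continuous_const (y := hg.toLp g)).inner (𝕜 := ℝ) h1
  refine h2.congr fun η => ?_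
  rw [L2.inner_def]
  refine integral_congr_ae ?_
  have h0 : Lp.compMeasurePreserving (k η) (measurePreserving_sub_const η) (hw.toLp w) = _ :=
    Lp.toLp_compMeasurePreserving hw (measurePreserving_sub_const η)
  rw [h0]
  filter_upwards [hg.coeFn_toLp,
    (hw.comp_measurePreserving (measurePreserving_sub_const η)).coeFn_toLp] with r h3 h4
  rw [h3]
  have h5 : (((hw.comp_measurePreserving (measurePreserving_sub_const η)).toLp _ :
    Lp ℝ 2 volume) : ℝ → ℝ) r = w (r - η) := h4
  simp only [Real.inner_apply] at h5 ⊢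
  congr 1

theorem integrable_mul_comp_sub_prod (hg : MemLp g 2 volume) (hw : MemLp w 2 volume) (a b : ℝ) :
    Integrable (fun z : ℝ × ℝ => g z.1 * w (z.1 - z.2))
      (volume.prod (volume.restrict (uIoc a b))) := by
  have : IsFiniteMeasure (volume.restrict (uIoc a b)) := ⟨by simp [uIoc]⟩
  have h1 := hg.comp_fst (volume.restrict (uIoc a b))
  have h2 := (hw.comp_fst (volume.restrict (uIoc a b))).comp_measurePreserving
    (measurePreserving_sub_prod volume (volume.restrict (uIoc a b)))
  exact h1.integrable_mul h2

/-- Substituting $s=r-\eta$ and applying Fubini turns the pairing with a Steklov integral into the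
primitive of the continuous correlation function. -/
theorem integral_mul_integral_eq (hg : MemLp g 2 volume) (hw : MemLp w 2 volume) (δ : ℝ) :
    ∫ r, g r * ∫ s in (r - δ)..r, w s = ∫ η in (0 : ℝ)..δ, ∫ r, g r * w (r - η) := by
  have h := integrable_mul_comp_sub_prod hg hw 0 δ
  rw [intervalIntegral_integral_swap (f := fun η r => g r * w (r - η)) h.swap]
  refine integral_congr_ae (Eventually.of_forall fun r => ?_)
  simp only [intervalIntegral.integral_const_mul, intervalIntegral.integral_comp_sub_left, sub_zero]

theorem integrable_mul_integral (hg : MemLp g 2 volume) (hw : MemLp w 2 volume) (δ : ℝ) :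
    Integrable (fun r => g r * ∫ s in (r - δ)..r, w s) := by
  have h := (integrable_mul_comp_sub_prod hg hw 0 δ).integral_prod_left
  rcases le_total 0 δ with hδ | hδ
  · refine h.congr (Eventually.of_forall fun r => ?_)
    simp only
    rw [uIoc_of_le hδ, ← intervalIntegral.integral_of_le hδ]
    simp only [intervalIntegral.integral_const_mul, intervalIntegral.integral_comp_sub_left, sub_zero]
  · refine h.neg.congr (Eventually.of_forall fun r => ?_)
    simp only [Pi.neg_apply]
    rw [uIoc_of_ge hδ, ← intervalIntegral.integral_of_ge hδ]
    simp only [intervalIntegral.integral_const_mul, intervalIntegral.integral_comp_sub_left, sub_zero]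

theorem abs_integral_mul_comp_sub_le (hg : MemLp g 2 volume) (hw : MemLp w 2 volume) (η : ℝ) :
    |∫ r, g r * w (r - η)| ≤ (∫ r, g r ^ 2) + ∫ r, w r ^ 2 := by
  have h2 : Integrable fun r => w (r - η) ^ 2 :=
    (hw.comp_measurePreserving (measurePreserving_sub_const η)).integrable_sq
  have e : ∫ r, w r ^ 2 = ∫ r, w (r - η) ^ 2 :=
    (integral_sub_right_eq_self (fun r => w r ^ 2) η).symm
  rw [e, ← integral_add hg.integrable_sq h2]
  refine (norm_integral_le_integral_norm (fun r => g r * w (r - η))).trans ?_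
  refine integral_mono_of_nonneg (Eventually.of_forall fun _ => norm_nonneg _)
    (hg.integrable_sq.add h2) (Eventually.of_forall fun r => ?_)
  simp only [norm_mul, Real.norm_eq_abs]
  nlinarith [sq_nonneg (|g r| - |w (r - η)|), sq_abs (g r), sq_abs (w (r - η)), sq_nonneg (|g r|),
    sq_nonneg (|w (r - η)|)]

/-- The bound does not depend on $\delta$: it is the majorant for dominated convergence in $x$ later
on. -/
theorem abs_integral_mul_average_le (hg : MemLp g 2 volume) (hw : MemLp w 2 volume) {δ : ℝ}
    (hδ : 0 < δ) :
    |δ⁻¹ * ∫ r, g r * ∫ s in (r - δ)..r, w s| ≤ (∫ r, g r ^ 2) + ∫ r, w r ^ 2 := by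
  rw [integral_mul_integral_eq hg hw, abs_mul, abs_of_pos (inv_pos.2 hδ), inv_mul_le_iff₀ hδ]
  have := intervalIntegral.norm_integral_le_of_norm_le_const (a := 0) (b := δ)
    (f := fun η => ∫ r, g r * w (r - η)) (C := (∫ r, g r ^ 2) + ∫ r, w r ^ 2)
    fun η _ => abs_integral_mul_comp_sub_le hg hw η
  simpa [abs_of_pos hδ, mul_comm] using this

/-- The backward Steklov averages of a square integrable function converge weakly to it. -/
theorem tendsto_integral_mul_average (hg : MemLp g 2 volume) (hw : MemLp w 2 volume) :
    Tendsto (fun δ : ℝ => δ⁻¹ * ∫ r, g r * ∫ s in (r - δ)..r, w s) (𝓝[>] 0)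
      (𝓝 (∫ r, g r * w r)) := by
  simp_rw [integral_mul_integral_eq hg hw]
  have hc := continuous_integral_mul_comp_sub hg hw
  -- The quantity is the difference quotient at $0$ of a primitive, so it tends to the value of the
  -- correlation at $\eta=0$.
  have h := (hc.integral_hasStrictDerivAt 0 0).hasDerivAt.tendsto_slope_zero_right
  simpa using h

end Translation

/-! ### Poincaré's inequality for test functions. -/

section TestFunctions

variable {N : ℕ} {Ω : Set (EuclideanSpace ℝ (Fin N))} {φ : EuclideanSpace ℝ (Fin N) → ℝ}

theorem norm_gradient (φ : EuclideanSpace ℝ (Fin N) → ℝ) (x : EuclideanSpace ℝ (Fin N)) :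
    ‖gradient φ x‖ = ‖fderiv ℝ φ x‖ := by
  simp [gradient]

theorem IsTestFunction.continuous_gradient (hφ : IsTestFunction Ω φ) :
    Continuous (gradient φ) :=
  (InnerProductSpace.toDual ℝ _).symm.continuous.comp (hφ.1.continuous_fderiv (by simp))

theorem IsTestFunction.hasCompactSupport_gradient (hφ : IsTestFunction Ω φ) :
    HasCompactSupport (gradient φ) :=
  (hφ.2.1.fderiv (𝕜 := ℝ)).comp_left (g := (InnerProductSpace.toDual ℝ _).symm) (by simp)

theorem IsTestFunction.memLp (hφ : IsTestFunction Ω φ) (q : ℝ≥0∞) :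
    MemLp φ q (volume.restrict Ω) :=
  (hφ.1.continuous.memLp_of_hasCompactSupport hφ.2.1).restrict Ω

theorem IsTestFunction.memLp_gradient (hφ : IsTestFunction Ω φ) (q : ℝ≥0∞) :
    MemLp (gradient φ) q (volume.restrict Ω) :=
  (hφ.continuous_gradient.memLp_of_hasCompactSupport hφ.hasCompactSupport_gradient).restrict Ω

/-- Poincaré's inequality for test functions. -/
theorem IsTestFunction.integral_sq_le (hN : 1 ≤ N) {R : ℝ}
    (hR : ∀ x ∈ Ω, ‖x‖ ≤ R) (hφ : IsTestFunction Ω φ) :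
    ∫ x, φ x ^ 2 ≤ 4 * R ^ 2 * ∫ x, ‖gradient φ x‖ ^ 2 := by
  classical
  let i : Fin N := ⟨0, hN⟩
  let v : EuclideanSpace ℝ (Fin N) := EuclideanSpace.single i 1
  let l : EuclideanSpace ℝ (Fin N) →L[ℝ] ℝ := EuclideanSpace.proj i
  have hlv : l v = 1 := by simp [l, v]
  have hl (x) : |l x| ≤ ‖x‖ := by
    simpa [l] using PiLp.norm_apply_le x i
  have hv : ‖v‖ = 1 := by simp [v]
  have hc := hφ.1.continuous
  have hd : Differentiable ℝ φ := hφ.1.differentiable (by simp)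
  have hcf : Continuous (fderiv ℝ φ) := hφ.1.continuous_fderiv (by simp)
  have hfd (x) : fderiv ℝ (fun x => φ x ^ 2) x v = 2 * φ x * fderiv ℝ φ x v := by
    have := ((hd x).hasFDerivAt.pow 2).fderiv
    rw [this]; simp
  have hfl (x) : fderiv ℝ l x v = 1 := by rw [l.fderiv, hlv]
  have hsq : HasCompactSupport fun x => φ x ^ 2 :=
    hφ.2.1.comp_left (g := fun y : ℝ => y ^ 2) (by simp)
  -- Integration by parts against the coordinate function `l`, whose derivative along `v` is $1$:
  -- $\int\varphi^2=-\int 2\varphi\,\partial_v\varphi\; l$, with $|l|\le R$ on $\Omega$.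
  have key := integral_mul_fderiv_eq_neg_fderiv_mul_of_integrable (μ := volume)
    (f := fun x => φ x ^ 2) (g := l) (v := v)
    (by
      simp only [hfd]
      refine Continuous.integrable_of_hasCompactSupport (by fun_prop) ?_
      exact ((hφ.2.1.mul_left (f := fun _ => (2 : ℝ))).mul_right
        (f' := fun x => fderiv ℝ φ x v)).mul_right)
    (by
      simp only [hfl, mul_one]
      exact Continuous.integrable_of_hasCompactSupport (by fun_prop) hsq)
    (Continuous.integrable_of_hasCompactSupport (by fun_prop) hsq.mul_right)
    (fun x _ => (hd x).pow 2) (fun x _ => l.differentiableAt)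
  simp only [hfl, mul_one, hfd] at key
  have i1 : Integrable fun x => φ x ^ 2 :=
    Continuous.integrable_of_hasCompactSupport (by fun_prop) hsq
  have i2 : Integrable fun x => ‖gradient φ x‖ ^ 2 := by
    have := hφ.continuous_gradient
    exact Continuous.integrable_of_hasCompactSupport (by fun_prop)
      (hφ.hasCompactSupport_gradient.comp_left (g := fun y => ‖y‖ ^ 2) (by simp))
  -- Young's inequality, weighted so that half of $\int\varphi^2$ can be absorbed on the left; this
  -- produces the factor $4R^2$.
  have h1 : ∫ x, φ x ^ 2 ≤ ∫ x, ((1 / 2) * φ x ^ 2 + 2 * R ^ 2 * ‖gradient φ x‖ ^ 2) := by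
    refine (le_abs_self _).trans ?_
    rw [key, abs_neg]
    refine (norm_integral_le_integral_norm (fun x => 2 * φ x * fderiv ℝ φ x v * l x)).trans ?_
    refine integral_mono_of_nonneg (Eventually.of_forall fun _ => norm_nonneg _)
      ((i1.const_mul _).add (i2.const_mul _)) (Eventually.of_forall fun x => ?_)
    by_cases hx : x ∈ tsupport φ
    · have hxR : |l x| ≤ R := (hl x).trans (hR x (hφ.2.2 hx))
      have h3 : |fderiv ℝ φ x v| ≤ ‖gradient φ x‖ := by
        rw [norm_gradient]
        simpa [hv] using (fderiv ℝ φ x).le_opNorm v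
      have h4 : |fderiv ℝ φ x v| * |l x| ≤ ‖gradient φ x‖ * R :=
        mul_le_mul h3 hxR (abs_nonneg _) (norm_nonneg _)
      have h5 := mul_le_mul_of_nonneg_left h4 (abs_nonneg (φ x))
      simp only [norm_mul, Real.norm_eq_abs]
      rw [abs_of_pos (two_pos : (0 : ℝ) < 2)]
      nlinarith [sq_nonneg (|φ x| - 2 * R * ‖gradient φ x‖), sq_abs (φ x)]
    · have : φ x = 0 := image_eq_zero_of_notMem_tsupport hx
      simp only [this, mul_zero, zero_mul, norm_zero]
      positivity
  rw [integral_add (i1.const_mul _) (i2.const_mul _), integral_const_mul, integral_const_mul] at h1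
  linarith

theorem IsTestFunction.eLpNorm_le (hN : 1 ≤ N) {R : ℝ} (hR0 : 0 ≤ R)
    (hR : ∀ x ∈ Ω, ‖x‖ ≤ R) (hφ : IsTestFunction Ω φ) :
    eLpNorm φ 2 (volume.restrict Ω) ≤
      ENNReal.ofReal (2 * R) * eLpNorm (gradient φ) 2 (volume.restrict Ω) := by
  have h0 : eLpNorm φ 2 (volume.restrict Ω) = eLpNorm φ 2 volume :=
    eLpNorm_restrict_eq_of_support_subset ((subset_tsupport φ).trans hφ.2.2)
  have h1 : eLpNorm (gradient φ) 2 (volume.restrict Ω) = eLpNorm (gradient φ) 2 volume := by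
    refine eLpNorm_restrict_eq_of_support_subset fun x hx => hφ.2.2 ?_
    refine support_fderiv_subset ℝ ?_
    rw [Function.mem_support] at hx ⊢
    rwa [← norm_ne_zero_iff, norm_gradient, norm_ne_zero_iff] at hx
  rw [h0, h1]
  have m0 : MemLp φ 2 volume := hφ.1.continuous.memLp_of_hasCompactSupport hφ.2.1
  have m1 : MemLp (gradient φ) 2 volume :=
    hφ.continuous_gradient.memLp_of_hasCompactSupport hφ.hasCompactSupport_gradient
  rw [m0.eLpNorm_eq_integral_rpow_norm (by simp) (by simp),
    m1.eLpNorm_eq_integral_rpow_norm (by simp) (by simp), ← ENNReal.ofReal_mul (by positivity)]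
  refine ENNReal.ofReal_le_ofReal ?_
  have h2 := hφ.integral_sq_le hN hR
  simp only [ENNReal.toReal_ofNat, Real.rpow_ofNat, Real.norm_eq_abs, sq_abs]
  rw [← one_div, ← Real.sqrt_eq_rpow, ← Real.sqrt_eq_rpow]
  rw [show 2 * R = Real.sqrt (4 * R ^ 2) by
    rw [show 4 * R ^ 2 = (2 * R) ^ 2 by ring, Real.sqrt_sq (by positivity)],
    ← Real.sqrt_mul (by positivity)]
  exact Real.sqrt_le_sqrt h2

end TestFunctions

/-! ### Poincaré's inequality on $W_0^{1,p}$. -/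

section W0

variable {N : ℕ} {Ω : Set (EuclideanSpace ℝ (Fin N))} {p : ℝ}
  {v : EuclideanSpace ℝ (Fin N) → ℝ}
  {G : EuclideanSpace ℝ (Fin N) → EuclideanSpace ℝ (Fin N)}

theorem tendsto_eLpNorm_sub_of_le {X V : Type*} [MeasurableSpace X] {μ : Measure X}
    [IsFiniteMeasure μ] [NormedAddCommGroup V] {r q : ℝ≥0∞} (hrq : r ≤ q) (hr : r ≠ 0)
    {a : ℕ → X → V}
    (ha : ∀ n, AEStronglyMeasurable (a n) μ)
    (h : Tendsto (fun n => eLpNorm (a n) q μ) atTop (𝓝 0)) :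
    Tendsto (fun n => eLpNorm (a n) r μ) atTop (𝓝 0) := by
  have hK : μ univ ^ (1 / r.toReal - 1 / q.toReal) ≠ ⊤ := by
    refine ENNReal.rpow_ne_top_of_nonneg ?_ (measure_ne_top μ univ)
    rw [sub_nonneg]
    by_cases hq : q = ⊤
    · simp [hq]
    · exact one_div_le_one_div_of_le (ENNReal.toReal_pos hr (ne_top_of_le_ne_top hq hrq))
        (ENNReal.toReal_mono hq hrq)
  have h2 := ENNReal.Tendsto.mul_const h (Or.inr hK)
  rw [zero_mul] at h2
  exact tendsto_of_tendsto_of_tendsto_of_le_of_le tendsto_const_nhds h2 (fun _ => zero_le)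
    fun n => eLpNorm_le_eLpNorm_mul_rpow_measure_univ hrq (ha n)

/-- On a set of finite measure the $L^p$ approximation by test functions is also an $L^2$
approximation, so the inequality passes to the limit. -/
theorem MemW0.eLpNorm_le (hN : 1 ≤ N) {R : ℝ} (hR0 : 0 ≤ R)
    (hR : ∀ x ∈ Ω, ‖x‖ ≤ R) (hp : 2 < p) [IsFiniteMeasure (volume.restrict Ω)]
    (h : MemW0 Ω p v G) :
    eLpNorm v 2 (volume.restrict Ω) ≤
      ENNReal.ofReal (2 * R) * eLpNorm G 2 (volume.restrict Ω) := by
  obtain ⟨hv, hG, φ, hφ, h1, h2⟩ := h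
  have h2p : (2 : ℝ≥0∞) ≤ ENNReal.ofReal p := by
    rw [show (2 : ℝ≥0∞) = ENNReal.ofReal 2 by simp]
    exact ENNReal.ofReal_le_ofReal hp.le
  have m1 n : AEStronglyMeasurable (fun x => φ n x - v x) (volume.restrict Ω) :=
    ((hφ n).memLp 2).1.sub hv.1
  have m2 n : AEStronglyMeasurable (fun x => gradient (φ n) x - G x) (volume.restrict Ω) :=
    ((hφ n).memLp_gradient 2).1.sub hG.1
  have t1 := tendsto_eLpNorm_sub_of_le h2p (by simp) m1 h1
  have t2 := tendsto_eLpNorm_sub_of_le h2p (by simp) m2 h2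
  have hb n : eLpNorm v 2 (volume.restrict Ω) ≤
      eLpNorm (fun x => φ n x - v x) 2 (volume.restrict Ω) + ENNReal.ofReal (2 * R) *
        (eLpNorm (fun x => gradient (φ n) x - G x) 2 (volume.restrict Ω) +
          eLpNorm G 2 (volume.restrict Ω)) := by
    have e1 : v = φ n - fun x => φ n x - v x := by ext x; simp
    have e2 : gradient (φ n) = (fun x => gradient (φ n) x - G x) + G := by ext x; simp
    calc eLpNorm v 2 (volume.restrict Ω)
        ≤ eLpNorm (φ n) 2 (volume.restrict Ω) +
          eLpNorm (fun x => φ n x - v x) 2 (volume.restrict Ω) := by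
          conv_lhs => rw [e1]
          exact eLpNorm_sub_le ((hφ n).memLp 2).1 (m1 n) (by simp)
      _ ≤ _ := by
          rw [add_comm]
          gcongr
          refine ((hφ n).eLpNorm_le hN hR0 hR).trans ?_
          gcongr
          conv_lhs => rw [e2]
          exact eLpNorm_add_le (m2 n) hG.1 (by simp)
  have t3 := t1.add (ENNReal.Tendsto.const_mul (a := ENNReal.ofReal (2 * R))
    (t2.add_const (eLpNorm G 2 (volume.restrict Ω))) (Or.inr ENNReal.ofReal_ne_top))
  simp only [zero_add] at t3
  exact ge_of_tendsto' t3 hb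

/-- The $L^2$ Poincaré inequality is followed by Hölder from $L^2$ to $L^p$ for the gradient;
squaring creates the exponent $2/p$. -/
theorem exists_poincareConst (hN : 1 ≤ N) (hΩ : Bornology.IsBounded Ω) (hp : 2 < p) :
    ∃ C, PoincareConst Ω p C := by
  obtain ⟨R, hR⟩ := hΩ.exists_norm_le
  have hR' : ∀ x ∈ Ω, ‖x‖ ≤ max R 0 := fun x hx => (hR x hx).trans (le_max_left _ _)
  have : IsFiniteMeasure (volume.restrict Ω) := ⟨by simpa using hΩ.measure_lt_top⟩
  have h2p : (2 : ℝ≥0∞) ≤ ENNReal.ofReal p := by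
    rw [show (2 : ℝ≥0∞) = ENNReal.ofReal 2 by simp]
    exact ENNReal.ofReal_le_ofReal hp.le
  have hpp : (ENNReal.ofReal p).toReal = p := ENNReal.toReal_ofReal (by linarith)
  have hpos : 0 < p := by linarith
  set K : ℝ := 2 * max R 0 *
    ((volume.restrict Ω) univ ^ (1 / (2 : ℝ≥0∞).toReal - 1 / (ENNReal.ofReal p).toReal)).toReal
    with hK
  have hKn : (volume.restrict Ω) univ ^ (1 / (2 : ℝ≥0∞).toReal - 1 / (ENNReal.ofReal p).toReal)
      ≠ ⊤ := by
    refine ENNReal.rpow_ne_top_of_nonneg ?_ (measure_ne_top _ univ)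
    rw [sub_nonneg, hpp]
    exact one_div_le_one_div_of_le (by simp) (by simpa using hp.le)
  -- The summand $1$ only secures strict positivity, since `K` may vanish.
  refine ⟨1 / 2 * K ^ 2 + 1, by positivity, fun v G h => ?_⟩
  have hle := h.eLpNorm_le hN (le_max_right R 0) hR' hp
  have hv2 : MemLp v 2 (volume.restrict Ω) := h.1.mono_exponent h2p
  have hle2 : eLpNorm v 2 (volume.restrict Ω) ≤
      ENNReal.ofReal K * eLpNorm G (ENNReal.ofReal p) (volume.restrict Ω) := by
    refine hle.trans ?_
    rw [hK, ENNReal.ofReal_mul (p := 2 * max R 0) (by positivity), ENNReal.ofReal_toReal hKn,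
      mul_assoc]
    gcongr
    rw [mul_comm]
    exact eLpNorm_le_eLpNorm_mul_rpow_measure_univ h2p h.2.1.1
  have hK0 : 0 ≤ K := by positivity
  rw [hv2.eLpNorm_eq_integral_rpow_norm (by simp) (by simp),
    h.2.1.eLpNorm_eq_integral_rpow_norm (by simpa using hpos) (by simp),
    ← ENNReal.ofReal_mul hK0, ENNReal.ofReal_le_ofReal_iff (by positivity), hpp] at hle2
  simp only [ENNReal.toReal_ofNat, Real.rpow_ofNat, Real.norm_eq_abs, sq_abs] at hle2
  have hI : 0 ≤ ∫ x in Ω, ‖G x‖ ^ p := by positivity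
  have hJ : 0 ≤ ∫ x in Ω, v x ^ 2 := by positivity
  have h3 := pow_le_pow_left₀ (by positivity) hle2 2
  rw [mul_pow, ← Real.rpow_natCast, ← Real.rpow_mul hJ, ← Real.rpow_natCast (_ ^ p⁻¹),
    ← Real.rpow_mul hI] at h3
  have e1 : (2 : ℝ)⁻¹ * ((2 : ℕ) : ℝ) = 1 := by norm_num
  have e2 : p⁻¹ * ((2 : ℕ) : ℝ) = 2 / p := by push_cast; ring
  rw [e1, e2, Real.rpow_one] at h3
  have h4 : 0 ≤ (∫ x in Ω, ‖G x‖ ^ p) ^ (2 / p) := by positivity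
  nlinarith

end W0

/-! ### Duality pairings and their continuity. -/

section Pairing

variable {X V : Type*} [MeasurableSpace X] {μ : Measure X} [NormedAddCommGroup V]
  [InnerProductSpace ℝ V] {q r : ℝ≥0∞}

theorem integrable_inner_of_memLp [ENNReal.HolderTriple q r 1] {a b : X → V}
    (ha : MemLp a q μ) (hb : MemLp b r μ) : Integrable (fun x => inner ℝ (a x) (b x)) μ := by
  have h := ha.norm.integrable_mul hb.norm
  refine h.mono (ha.1.inner hb.1) (Eventually.of_forall fun x => ?_)
  simpa using abs_real_inner_le_norm (a x) (b x)

theorem tendsto_integral_inner [ENNReal.HolderTriple q r 1] {a b : X → V} {c : ℕ → X → V}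
    (ha : MemLp a q μ) (hb : MemLp b r μ) (hc : ∀ n, MemLp (c n) r μ)
    (h : Tendsto (fun n => eLpNorm (fun x => c n x - b x) r μ) atTop (𝓝 0)) :
    Tendsto (fun n => ∫ x, inner ℝ (a x) (c n x) ∂μ) atTop (𝓝 (∫ x, inner ℝ (a x) (b x) ∂μ)) := by
  refine tendsto_integral_of_L1' _ (integrable_inner_of_memLp ha hb).aestronglyMeasurable
    (Eventually.of_forall fun n => integrable_inner_of_memLp ha (hc n)) ?_
  have h2 := ENNReal.Tendsto.const_mul h (Or.inr ha.2.ne)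
  rw [mul_zero] at h2
  refine tendsto_of_tendsto_of_tendsto_of_le_of_le tendsto_const_nhds h2 (fun _ => zero_le)
    fun n => ?_
  refine (le_trans ?_ (eLpNorm_le_eLpNorm_mul_eLpNorm_of_nnnorm (p := q) (q := r) (r := 1)
    ha.1 ((hc n).sub hb).1 (fun y z => inner ℝ y z) 1 (Eventually.of_forall fun x => ?_))).trans ?_
  rotate_left
  · simpa using nnnorm_inner_le_nnnorm (𝕜 := ℝ) (a x) (c n x - b x)
  · simp only [ENNReal.coe_one, one_mul]
    rfl
  · refine le_of_eq (eLpNorm_congr_ae (Eventually.of_forall fun x => ?_))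
    simp [inner_sub_right]

end Pairing

/-! ### Testing the weak equation and convexity of the Dirichlet energy. -/

section Equation

variable {N : ℕ} {Ω : Set (EuclideanSpace ℝ (Fin N))} {p : ℝ}
  {v : EuclideanSpace ℝ (Fin N) → ℝ}
  {G H : EuclideanSpace ℝ (Fin N) → EuclideanSpace ℝ (Fin N)}

/-- The flux has norm $|G|^{p-1}$, so it lies in the dual exponent and pairs with gradients in
$L^p$. -/
theorem memLp_flux (hp : 2 < p) (hG : MemLp G (ENNReal.ofReal p) (volume.restrict Ω)) :
    MemLp (fun x => ‖G x‖ ^ (p - 2) • G x) (ENNReal.ofReal (p / (p - 1))) (volume.restrict Ω) := by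
  have h1 := hG.norm_rpow_div (ENNReal.ofReal (p - 1))
  rw [ENNReal.toReal_ofReal (by linarith), ← ENNReal.ofReal_div_of_pos (by linarith)] at h1
  refine h1.mono ?_ (Eventually.of_forall fun x => ?_)
  · exact (hG.1.norm.aemeasurable.pow_const _).aestronglyMeasurable.smul hG.1
  · rw [norm_smul, Real.norm_of_nonneg (by positivity), Real.norm_of_nonneg (by positivity)]
    rcases eq_or_ne (G x) 0 with h | h
    · simp only [h, norm_zero, mul_zero]; positivity
    · nth_rewrite 2 [← Real.rpow_one ‖G x‖]
      rw [← Real.rpow_add (norm_pos_iff.2 h)]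
      refine le_of_eq (by ring_nf)

theorem holderTriple_flux (hp : 2 < p) :
    ENNReal.HolderTriple (ENNReal.ofReal (p / (p - 1))) (ENNReal.ofReal p) 1 := by
  have h : Real.HolderConjugate (p / (p - 1)) p := by
    rw [Real.holderConjugate_iff]
    refine ⟨by rw [lt_div_iff₀ (by linarith)]; linarith, ?_⟩
    have : p - 1 ≠ 0 := by linarith
    field_simp
    ring
  have := h.ennrealOfReal
  exact this

/-- The weak equation may be tested with all of `W_0^{1,p}`. -/
theorem integral_eq_of_memW0 [IsFiniteMeasure (volume.restrict Ω)] (hp : 2 < p)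
    (hG : MemLp G (ENNReal.ofReal p) (volume.restrict Ω)) {h : EuclideanSpace ℝ (Fin N) → ℝ}
    (hh : MemLp h 2 (volume.restrict Ω))
    (heq : ∀ φ : EuclideanSpace ℝ (Fin N) → ℝ, IsTestFunction Ω φ →
      (∫ x in Ω, inner ℝ (‖G x‖ ^ (p - 2) • G x) (gradient φ x)) = ∫ x in Ω, h x * φ x)
    (hv : MemW0 Ω p v H) :
    (∫ x in Ω, inner ℝ (‖G x‖ ^ (p - 2) • G x) (H x)) = ∫ x in Ω, h x * v x := by
  obtain ⟨hv, hH, φ, hφ, h1, h2⟩ := hv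
  have h2p : (2 : ℝ≥0∞) ≤ ENNReal.ofReal p := by
    rw [show (2 : ℝ≥0∞) = ENNReal.ofReal 2 by simp]
    exact ENNReal.ofReal_le_ofReal hp.le
  have t1 := tendsto_eLpNorm_sub_of_le h2p (by simp)
    (fun n => ((hφ n).memLp 2).1.sub hv.1) h1
  have l1 := tendsto_integral_inner hh (hv.mono_exponent h2p) (fun n => (hφ n).memLp 2) t1
  have := holderTriple_flux hp
  have l2 := tendsto_integral_inner (memLp_flux hp hG) hH (fun n => (hφ n).memLp_gradient _) h2
  simp_rw [fun n => heq _ (hφ n)] at l2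
  simp only [Real.inner_apply] at l1
  exact tendsto_nhds_unique l2 l1

/-- This is convexity of $|\cdot|^p/p$, comparing with the tangent at $a$; it reduces to
Cauchy–Schwarz and Young with exponents $p/(p-1)$ and $p$. -/
theorem young_flux {V : Type*} [NormedAddCommGroup V] [InnerProductSpace ℝ V] (hp : 2 < p)
    (a b : V) : 1 / p * ‖a‖ ^ p - 1 / p * ‖b‖ ^ p ≤ inner ℝ (‖a‖ ^ (p - 2) • a) (a - b) := by
  have hp0 : 0 < p := by linarith
  have h1 : inner ℝ (‖a‖ ^ (p - 2) • a) a = ‖a‖ ^ p := by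
    rw [real_inner_smul_left, real_inner_self_eq_norm_sq, ← Real.rpow_natCast,
      ← Real.rpow_add_of_nonneg (norm_nonneg a) (by linarith) (by norm_num)]
    norm_num
  have h2 : inner ℝ (‖a‖ ^ (p - 2) • a) b ≤ ‖a‖ ^ (p - 1) * ‖b‖ := by
    refine (real_inner_le_norm _ _).trans ?_
    rw [norm_smul, Real.norm_of_nonneg (by positivity)]
    refine mul_le_mul_of_nonneg_right (le_of_eq ?_) (norm_nonneg b)
    nth_rewrite 2 [← Real.rpow_one ‖a‖]
    rw [← Real.rpow_add_of_nonneg (norm_nonneg a) (by linarith) (by norm_num)]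
    ring_nf
  have h : Real.HolderConjugate (p / (p - 1)) p := by
    rw [Real.holderConjugate_iff]
    refine ⟨by rw [lt_div_iff₀ (by linarith)]; linarith, ?_⟩
    have : p - 1 ≠ 0 := by linarith
    field_simp
    ring
  have h3 := Real.young_inequality_of_nonneg (a := ‖a‖ ^ (p - 1)) (b := ‖b‖) (by positivity)
    (by positivity) h
  rw [← Real.rpow_mul (norm_nonneg a)] at h3
  have e : (p - 1) * (p / (p - 1)) = p := by
    have : p - 1 ≠ 0 := by linarith
    field_simp
  rw [e] at h3
  have e2 : ‖a‖ ^ p / (p / (p - 1)) = ‖a‖ ^ p - 1 / p * ‖a‖ ^ p := by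
    have : p - 1 ≠ 0 := by linarith
    field_simp
  rw [inner_sub_right, h1]
  rw [e2] at h3
  have e3 : ‖b‖ ^ p / p = 1 / p * ‖b‖ ^ p := by ring
  linarith

theorem inner_flux_self {V : Type*} [NormedAddCommGroup V] [InnerProductSpace ℝ V] (hp : 2 < p)
    (a : V) : inner ℝ (‖a‖ ^ (p - 2) • a) a = ‖a‖ ^ p := by
  rw [real_inner_smul_left, real_inner_self_eq_norm_sq, ← Real.rpow_natCast,
    ← Real.rpow_add_of_nonneg (norm_nonneg a) (by linarith) (by norm_num)]
  norm_num

theorem integrable_norm_rpow_of_memLp (hp : 2 < p) {X V : Type*} [MeasurableSpace X]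
    {μ : Measure X} [NormedAddCommGroup V] {G : X → V}
    (hG : MemLp G (ENNReal.ofReal p) μ) :
    Integrable (fun x => ‖G x‖ ^ p) μ := by
  have := hG.integrable_norm_rpow (by simp; linarith) (by simp)
  rwa [ENNReal.toReal_ofReal (by linarith)] at this

/-- The `p`-Dirichlet integral lies above its tangent at a solution of the weak equation. -/
theorem dirichlet_sub_le [IsFiniteMeasure (volume.restrict Ω)] (hp : 2 < p)
    {u h : EuclideanSpace ℝ (Fin N) → ℝ}
    (hu : MemW0 Ω p u G) (hh : MemLp h 2 (volume.restrict Ω))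
    (heq : ∀ φ : EuclideanSpace ℝ (Fin N) → ℝ, IsTestFunction Ω φ →
      (∫ x in Ω, inner ℝ (‖G x‖ ^ (p - 2) • G x) (gradient φ x)) = ∫ x in Ω, h x * φ x)
    (hv : MemW0 Ω p v H) :
    1 / p * (∫ x in Ω, ‖G x‖ ^ p) - 1 / p * (∫ x in Ω, ‖H x‖ ^ p) ≤
      ∫ x in Ω, h x * (u x - v x) := by
  have h2p : (2 : ℝ≥0∞) ≤ ENNReal.ofReal p := by
    rw [show (2 : ℝ≥0∞) = ENNReal.ofReal 2 by simp]
    exact ENNReal.ofReal_le_ofReal hp.le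
  have e1 := integral_eq_of_memW0 hp hu.2.1 hh heq hu
  have e2 := integral_eq_of_memW0 hp hu.2.1 hh heq hv
  have i1 : Integrable (fun x => h x * u x) (volume.restrict Ω) :=
    hh.integrable_mul (hu.1.mono_exponent h2p)
  have i2 : Integrable (fun x => h x * v x) (volume.restrict Ω) :=
    hh.integrable_mul (hv.1.mono_exponent h2p)
  have := holderTriple_flux hp
  have j1 := integrable_inner_of_memLp (memLp_flux hp hu.2.1) hu.2.1
  have j2 := integrable_inner_of_memLp (memLp_flux hp hu.2.1) hv.2.1
  simp_rw [mul_sub]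
  rw [integral_sub i1 i2, ← e1, ← e2, ← integral_sub j1 j2, ← integral_const_mul,
    ← integral_const_mul, ← integral_sub ((integrable_norm_rpow_of_memLp hp hu.2.1).const_mul _)
    ((integrable_norm_rpow_of_memLp hp hv.2.1).const_mul _)]
  refine integral_mono (((integrable_norm_rpow_of_memLp hp hu.2.1).const_mul _).sub
    ((integrable_norm_rpow_of_memLp hp hv.2.1).const_mul _)) (j1.sub j2) fun x => ?_
  simpa [inner_sub_right] using young_flux hp (G x) (H x)

end Equation

/-- An integrable function on a product vanishes if its integrals over all boxes do. -/
theorem ae_eq_zero_of_forall_setIntegral_prod_eq_zero {X Y : Type*} [MeasurableSpace X]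
    [MeasurableSpace Y] {μ : Measure X} {ν : Measure Y} {d : X × Y → ℝ}
    (hd : Integrable d (μ.prod ν))
    (h : ∀ A B, MeasurableSet A → MeasurableSet B → ∫ z in A ×ˢ B, d z ∂(μ.prod ν) = 0) :
    d =ᵐ[μ.prod ν] 0 := by
  refine hd.ae_eq_zero_of_forall_setIntegral_eq_zero fun s hs hfin => ?_
  clear hfin
  have huniv : ∫ z, d z ∂(μ.prod ν) = 0 := by
    simpa using h univ univ MeasurableSet.univ MeasurableSet.univ
  induction s, hs using MeasurableSpace.induction_on_inter generateFrom_prod.symm isPiSystem_prod with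
  | empty => simp
  | basic t ht =>
    obtain ⟨A, hA, B, hB, rfl⟩ := ht
    exact h A B hA hB
  | compl t ht ih =>
    have h1 := integral_add_compl ht hd
    rw [ih, huniv, zero_add] at h1
    exact h1
  | iUnion f hf hm ih =>
    rw [integral_iUnion hm hf hd.integrableOn]
    simp [ih]

/-! ### Curves given by an initial value and a time derivative. -/

section Evolution

variable {X : Type*} [MeasurableSpace X]

/-- The curve starting at `u₀` with time derivative `W`. -/
def evolution (u₀ : X → ℝ) (W : ℝ × X → ℝ) (t : ℝ) (x : X) : ℝ :=
  u₀ x + ∫ s in (0 : ℝ)..t, W (s, x)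

variable {ν : Measure X} {u₀ : X → ℝ} {W : ℝ × X → ℝ} {T : ℝ}

/-- The moving endpoint is put into an indicator, so that measurability of integrals with parameters
applies. -/
theorem stronglyMeasurable_integral_evolution (hW : StronglyMeasurable W) [SFinite ν] :
    StronglyMeasurable fun z : ℝ × X => ∫ s in (0 : ℝ)..z.1, W (s, z.2) := by
  simp only [intervalIntegral]
  have hW' : StronglyMeasurable fun q : (ℝ × X) × ℝ => W (q.2, q.1.2) :=
    hW.comp_measurable (by fun_prop)
  have h1 : MeasurableSet {q : (ℝ × X) × ℝ | q.2 ∈ Ioc 0 q.1.1} :=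
    (measurableSet_lt measurable_const measurable_snd).inter
      (measurableSet_le measurable_snd measurable_fst.fst)
  have h2 : MeasurableSet {q : (ℝ × X) × ℝ | q.2 ∈ Ioc q.1.1 0} :=
    (measurableSet_lt measurable_fst.fst measurable_snd).inter
      (measurableSet_le measurable_snd measurable_const)
  have e1 : (fun z : ℝ × X => ∫ s in Ioc 0 z.1, W (s, z.2)) = fun z : ℝ × X =>
      ∫ s, ({q : (ℝ × X) × ℝ | q.2 ∈ Ioc 0 q.1.1}.indicator (fun q => W (q.2, q.1.2))) (z, s) := by
    ext z
    rw [← integral_indicator measurableSet_Ioc]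
    rfl
  have e2 : (fun z : ℝ × X => ∫ s in Ioc z.1 0, W (s, z.2)) = fun z : ℝ × X =>
      ∫ s, ({q : (ℝ × X) × ℝ | q.2 ∈ Ioc q.1.1 0}.indicator (fun q => W (q.2, q.1.2))) (z, s) := by
    ext z
    rw [← integral_indicator measurableSet_Ioc]
    rfl
  have m1 := (hW'.indicator h1).integral_prod_right' (ν := (volume : Measure ℝ))
  have m2 := (hW'.indicator h2).integral_prod_right' (ν := (volume : Measure ℝ))
  rw [← e1] at m1
  rw [← e2] at m2
  exact m1.sub m2

theorem aestronglyMeasurable_evolution (hW : StronglyMeasurable W) [SFinite ν]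
    (hu₀ : AEStronglyMeasurable u₀ ν) (μ : Measure ℝ) [SFinite μ] :
    AEStronglyMeasurable (Function.uncurry (evolution u₀ W)) (μ.prod ν) :=
  hu₀.comp_snd.add (stronglyMeasurable_integral_evolution (ν := ν) hW).aestronglyMeasurable

theorem aestronglyMeasurable_evolution_slice (hW : StronglyMeasurable W) [SFinite ν]
    (hu₀ : AEStronglyMeasurable u₀ ν) (t : ℝ) :
    AEStronglyMeasurable (evolution u₀ W t) ν :=
  hu₀.add ((stronglyMeasurable_integral_evolution (ν := ν) hW).comp_measurable
    measurable_prodMk_left).aestronglyMeasurable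

theorem ae_integrable_slice [SFinite ν] (hWi : Integrable W (volume.prod ν)) :
    ∀ᵐ x ∂ν, Integrable (fun t => W (t, x)) :=
  hWi.prod_left_ae

theorem memLp_two_slice [SFinite ν] (hW : StronglyMeasurable W)
    (hW2 : MemLp W 2 (volume.prod ν)) : ∀ᵐ x ∂ν, MemLp (fun t => W (t, x)) 2 volume := by
  filter_upwards [hW2.integrable_sq.prod_left_ae] with x hx
  exact (memLp_two_iff_integrable_sq
    (hW.comp_measurable measurable_prodMk_right).aestronglyMeasurable).2 hx

theorem integrable_evolution [IsFiniteMeasure ν] (hW : StronglyMeasurable W)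
    (hWi : Integrable W (volume.prod ν)) (hu₀ : Integrable u₀ ν) (μ : Measure ℝ)
    [IsFiniteMeasure μ] :
    Integrable (Function.uncurry (evolution u₀ W)) (μ.prod ν) := by
  have h1 : Integrable (fun z : ℝ × X => u₀ z.2) (μ.prod ν) := hu₀.comp_snd μ
  have h2 : Integrable (fun z : ℝ × X => ∫ s, ‖W (s, z.2)‖) (μ.prod ν) :=
    (hWi.norm.integral_prod_right).comp_snd μ
  refine (h1.norm.add h2).mono' (aestronglyMeasurable_evolution hW hu₀.1 μ) ?_
  have h3 := ae_integrable_slice hWi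
  have h4 : ∀ᵐ z ∂(μ.prod ν), Integrable (fun t => W (t, z.2)) :=
    Measure.quasiMeasurePreserving_snd.ae h3
  filter_upwards [h4] with z hz
  simp only [Function.uncurry, evolution, Pi.add_apply]
  refine (norm_add_le _ _).trans (add_le_add le_rfl ?_)
  refine intervalIntegral.norm_integral_le_integral_norm_uIoc.trans ?_
  exact setIntegral_le_integral hz.norm (Eventually.of_forall fun _ => norm_nonneg _)

end Evolution

/-! ### Weak time derivatives and tensor products of test functions. -/

section WeakDerivative

variable {N : ℕ} {Ω : Set (EuclideanSpace ℝ (Fin N))} {T : ℝ}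

theorem volume_restrict_cylinder (T : ℝ) (Ω : Set (EuclideanSpace ℝ (Fin N))) :
    (volume : Measure (ℝ × EuclideanSpace ℝ (Fin N))).restrict (Ioo 0 T ×ˢ Ω) =
      (volume.restrict (Ioo 0 T)).prod (volume.restrict Ω) := by
  rw [Measure.volume_eq_prod, Measure.prod_restrict]

theorem IsTestFunction.prod {θ : ℝ → ℝ} {ψ : EuclideanSpace ℝ (Fin N) → ℝ} {I : Set ℝ}
    (hθ : IsTestFunction I θ) (hψ : IsTestFunction Ω ψ) :
    IsTestFunction (I ×ˢ Ω) (fun z : ℝ × EuclideanSpace ℝ (Fin N) => θ z.1 * ψ z.2) := by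
  have hs : Function.support (fun z : ℝ × EuclideanSpace ℝ (Fin N) => θ z.1 * ψ z.2) ⊆
      tsupport θ ×ˢ tsupport ψ := by
    intro z hz
    exact ⟨subset_tsupport _ (left_ne_zero_of_mul hz), subset_tsupport _ (right_ne_zero_of_mul hz)⟩
  have hc : IsCompact (tsupport θ ×ˢ tsupport ψ) := hθ.2.1.isCompact.prod hψ.2.1.isCompact
  have ht := closure_minimal hs hc.isClosed
  refine ⟨(hθ.1.comp contDiff_fst).mul (hψ.1.comp contDiff_snd), ?_, ?_⟩
  · exact hc.of_isClosed_subset (isClosed_tsupport _) ht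
  · exact ht.trans (prod_mono hθ.2.2 hψ.2.2)

/-- A test function on `(0,T)` is on `(0,T)` the derivative of a test function on `(-∞,T)`. -/
theorem exists_primitive_isTestFunction {η : ℝ → ℝ} (hη : IsTestFunction (Ioo 0 T) η) :
    ∃ θ : ℝ → ℝ, IsTestFunction (Iio T) θ ∧ ∀ t ∈ Ioo 0 T, deriv θ t = η t := by
  obtain ⟨hηs, hηc, hηT⟩ := hη
  obtain ⟨S, hST, hS⟩ : ∃ S < T, ∀ t, S < t → η t = 0 := by
    rcases (tsupport η).eq_empty_or_nonempty with h | h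
    · exact ⟨T - 1, by linarith, fun t _ => image_eq_zero_of_notMem_tsupport (by simp [h])⟩
    · obtain ⟨S, hS1, hS2⟩ := hηc.isCompact.exists_isGreatest h
      refine ⟨S, (hηT hS1).2, fun t ht => image_eq_zero_of_notMem_tsupport fun h' => ?_⟩
      exact absurd (hS2 h') (not_le.2 ht)
  have hc : Continuous η := hηs.continuous
  have hP : ∀ t, HasDerivAt (fun t => ∫ s in T..t, η s) (η t) t := fun t =>
    (hc.integral_hasStrictDerivAt T t).hasDerivAt
  have hPs : ContDiff ℝ ∞ (fun t => ∫ s in T..t, η s) := by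
    rw [contDiff_infty_iff_deriv]
    refine ⟨fun t => (hP t).differentiableAt, ?_⟩
    rwa [show deriv (fun t => ∫ s in T..t, η s) = η from funext fun t => (hP t).deriv]
  -- The primitive based at $T$ vanishes to the right of $S$. On the left it may be a nonzero
  -- constant, so it is cut off by a function that is $0$ for $t\le-1$ and $1$ for $t\ge0$.
  have hχ : ContDiff ℝ ∞ fun t : ℝ => Real.smoothTransition (t + 1) :=
    Real.smoothTransition.contDiff.comp (contDiff_id.add contDiff_const)
  have hsupp : Function.support (fun t => Real.smoothTransition (t + 1) * ∫ s in T..t, η s) ⊆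
      Icc (-1) S := by
    intro t ht
    constructor
    · by_contra h
      exact left_ne_zero_of_mul ht (Real.smoothTransition.zero_of_nonpos (by linarith))
    · by_contra h
      refine right_ne_zero_of_mul ht (intervalIntegral.integral_zero_ae ?_)
      refine Eventually.of_forall fun s hs => hS s ?_
      push Not at h
      rcases le_total T t with h1 | h1
      · rw [uIoc_of_le h1] at hs; linarith [hs.1]
      · rw [uIoc_of_ge h1] at hs; linarith [hs.1]
  have hts := closure_minimal hsupp isClosed_Icc
  refine ⟨fun t => Real.smoothTransition (t + 1) * ∫ s in T..t, η s, ⟨hχ.mul hPs, ?_, ?_⟩, ?_⟩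
  · exact isCompact_Icc.of_isClosed_subset (isClosed_tsupport _) hts
  · exact hts.trans fun t ht => lt_of_le_of_lt ht.2 hST
  · intro t ht
    refine HasDerivAt.deriv ((hP t).congr_of_eventuallyEq ?_)
    filter_upwards [Ioi_mem_nhds ht.1] with s hs
    rw [Real.smoothTransition.one_of_one_le (by linarith [mem_Ioi.1 hs]), one_mul]

variable {u₀ : EuclideanSpace ℝ (Fin N) → ℝ} {W : ℝ × EuclideanSpace ℝ (Fin N) → ℝ}

theorem IsTestFunction.exists_bound {X : Type*} [NormedAddCommGroup X] [NormedSpace ℝ X]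
    {U : Set X} {φ : X → ℝ} (hφ : IsTestFunction U φ) : ∃ C, ∀ x, ‖φ x‖ ≤ C :=
  hφ.2.1.exists_bound_of_continuous hφ.1.continuous

/-- Integration by parts in time for an evolution with an integrable time derivative. -/
theorem integral_evolution_mul_deriv [IsFiniteMeasure (volume.restrict Ω)] (hT : 0 < T)
    (hW : StronglyMeasurable W) (hWi : Integrable W (volume.prod (volume.restrict Ω)))
    (hu₀ : Integrable u₀ (volume.restrict Ω)) {θ : ℝ → ℝ} {ψ : EuclideanSpace ℝ (Fin N) → ℝ}
    (hθ : IsTestFunction (Iio T) θ) (hψ : IsTestFunction Ω ψ) :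
    (∫ z in Ioo 0 T ×ˢ Ω, evolution u₀ W z.1 z.2 * (deriv θ z.1 * ψ z.2)) +
      (∫ x in Ω, u₀ x * (θ 0 * ψ x)) = - ∫ z in Ioo 0 T ×ˢ Ω, W z * (θ z.1 * ψ z.2) := by
  obtain ⟨C, hC⟩ := hψ.exists_bound
  obtain ⟨D, hD⟩ := hθ.exists_bound
  have hθ1 : ContDiff ℝ 1 θ := hθ.1.of_le (by exact_mod_cast le_top)
  have hdc : Continuous (deriv θ) := hθ1.continuous_deriv le_rfl
  obtain ⟨D', hD'⟩ := hθ.2.1.deriv.exists_bound_of_continuous hdc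
  have hψc := hψ.1.continuous
  have hθc := hθ.1.continuous
  have i1 : Integrable (fun z : ℝ × EuclideanSpace ℝ (Fin N) =>
      evolution u₀ W z.1 z.2 * (deriv θ z.1 * ψ z.2))
      ((volume.restrict (Ioo 0 T)).prod (volume.restrict Ω)) := by
    refine (integrable_evolution hW hWi hu₀ _).mul_bdd (c := D' * C)
      (Continuous.aestronglyMeasurable (by fun_prop)) (Eventually.of_forall fun z => ?_)
    rw [norm_mul]
    exact mul_le_mul (hD' _) (hC _) (norm_nonneg _) ((norm_nonneg _).trans (hD' 0))
  have i2 : Integrable (fun z : ℝ × EuclideanSpace ℝ (Fin N) => W z * (θ z.1 * ψ z.2))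
      ((volume.restrict (Ioo 0 T)).prod (volume.restrict Ω)) := by
    have hWi' : Integrable W ((volume.restrict (Ioo 0 T)).prod (volume.restrict Ω)) :=
      hWi.mono_measure (Measure.prod_mono Measure.restrict_le_self le_rfl)
    refine hWi'.mul_bdd (c := D * C)
      (Continuous.aestronglyMeasurable (by fun_prop)) (Eventually.of_forall fun z => ?_)
    rw [norm_mul]
    exact mul_le_mul (hD _) (hC _) (norm_nonneg _) ((norm_nonneg _).trans (hD 0))
  have i3 : Integrable (fun x => u₀ x * (θ 0 * ψ x)) (volume.restrict Ω) := by
    refine hu₀.mul_bdd (c := D * C)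
      (Continuous.aestronglyMeasurable (by fun_prop)) (Eventually.of_forall fun z => ?_)
    rw [norm_mul]
    exact mul_le_mul (hD _) (hC _) (norm_nonneg _) ((norm_nonneg _).trans (hD 0))
  rw [volume_restrict_cylinder, integral_prod_symm _ i1, integral_prod_symm _ i2,
    ← integral_add i1.integral_prod_right i3, ← integral_neg]
  refine integral_congr_ae ?_
  filter_upwards [ae_integrable_slice hWi] with x hx
  have hA := absolutelyContinuousOnInterval_add_integral (c := u₀ x) (hx.intervalIntegrable (a := 0) (b := T))
  have hB : AbsolutelyContinuousOnInterval θ 0 T := hθ1.contDiffOn.absolutelyContinuousOnInterval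
  have h := hA.integral_mul_deriv_eq_deriv_mul hB
  -- Hence the boundary term at $T$ disappears, and the one at $0$ is the term with $u_0$.
  have hθT : θ T = 0 := image_eq_zero_of_notMem_tsupport fun h' => lt_irrefl _ (mem_Iio.1 (hθ.2.2 h'))
  have e1 : ∫ t in (0 : ℝ)..T, deriv (fun t => u₀ x + ∫ s in (0 : ℝ)..t, W (s, x)) t * θ t =
      ∫ t in (0 : ℝ)..T, W (t, x) * θ t := by
    refine intervalIntegral.integral_congr_ae ?_
    have := ae_deriv_comp_integral (F := id) (f := fun _ => 1) (c := u₀ x) (fun y => hasDerivAt_id y)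
      (hx.intervalIntegrable (a := 0) (b := T))
    filter_upwards [this] with t ht htb
    have h2 := ht (uIoc_subset_uIcc htb)
    simp only [id, one_mul] at h2
    rw [h2]
  rw [e1, hθT] at h
  simp only [mul_zero, intervalIntegral.integral_same, add_zero, zero_sub] at h
  have c1 : ∫ t in Ioo 0 T, evolution u₀ W t x * (deriv θ t * ψ x) =
      (∫ t in (0 : ℝ)..T, (u₀ x + ∫ s in (0 : ℝ)..t, W (s, x)) * deriv θ t) * ψ x := by
    rw [intervalIntegral.integral_of_le hT.le, integral_Ioc_eq_integral_Ioo, ← integral_mul_const]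
    simp only [evolution, mul_assoc]
  have c2 : ∫ t in Ioo 0 T, W (t, x) * (θ t * ψ x) =
      (∫ t in (0 : ℝ)..T, W (t, x) * θ t) * ψ x := by
    rw [intervalIntegral.integral_of_le hT.le, integral_Ioc_eq_integral_Ioo, ← integral_mul_const]
    simp only [mul_assoc]
  simp only [c1, c2, h]
  ring

/-- A function that is orthogonal to all tensor products of test functions vanishes. -/
theorem ae_eq_zero_of_forall_tensor (hΩ : IsOpen Ω)
    {d : ℝ × EuclideanSpace ℝ (Fin N) → ℝ}
    (hd : Integrable d ((volume.restrict (Ioo 0 T)).prod (volume.restrict Ω)))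
    (h : ∀ η ψ, IsTestFunction (Ioo 0 T) η → IsTestFunction Ω ψ →
      ∫ z, d z * (η z.1 * ψ z.2) ∂((volume.restrict (Ioo 0 T)).prod (volume.restrict Ω)) = 0) :
    d =ᵐ[(volume.restrict (Ioo 0 T)).prod (volume.restrict Ω)] 0 := by
  have hψi {ψ : EuclideanSpace ℝ (Fin N) → ℝ} (hψ : IsTestFunction Ω ψ) :
      Integrable (fun z : ℝ × EuclideanSpace ℝ (Fin N) => d z * ψ z.2)
        ((volume.restrict (Ioo 0 T)).prod (volume.restrict Ω)) := by
    obtain ⟨C, hC⟩ := hψ.exists_bound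
    have := hψ.1.continuous
    exact hd.mul_bdd (c := C) (Continuous.aestronglyMeasurable (by fun_prop))
      (Eventually.of_forall fun z => hC _)
  have h1 {ψ : EuclideanSpace ℝ (Fin N) → ℝ} (hψ : IsTestFunction Ω ψ) :
      ∀ᵐ t ∂(volume.restrict (Ioo 0 T)), ∫ x in Ω, d (t, x) * ψ x = 0 := by
    rw [ae_restrict_iff' measurableSet_Ioo]
    refine isOpen_Ioo.ae_eq_zero_of_integral_contDiff_smul_eq_zero
      (IntegrableOn.locallyIntegrableOn (hψi hψ).integral_prod_left) fun η h2 h3 h4 => ?_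
    have hη : IsTestFunction (Ioo 0 T) η := ⟨h2, h3, h4⟩
    have h5 := h η ψ hη hψ
    obtain ⟨C, hC⟩ := hη.exists_bound
    have hηc := hη.1.continuous
    have i1 : Integrable (fun z : ℝ × EuclideanSpace ℝ (Fin N) => d z * (η z.1 * ψ z.2))
        ((volume.restrict (Ioo 0 T)).prod (volume.restrict Ω)) := by
      have := (hψi hψ).mul_bdd (g := fun z => η z.1) (c := C)
        (Continuous.aestronglyMeasurable (by fun_prop)) (Eventually.of_forall fun z => hC _)
      refine this.congr (Eventually.of_forall fun z => ?_)
      simp only; ring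
    rw [integral_prod _ i1] at h5
    rw [← h5, ← setIntegral_eq_integral_of_forall_compl_eq_zero (s := Ioo 0 T)]
    · refine integral_congr_ae (Eventually.of_forall fun t => ?_)
      simp only [smul_eq_mul]
      rw [← integral_const_mul]
      refine integral_congr_ae (Eventually.of_forall fun x => ?_)
      simp only; ring
    · intro t ht
      rw [image_eq_zero_of_notMem_tsupport (fun h' => ht (h4 h')), zero_smul]
  refine ae_eq_zero_of_forall_setIntegral_prod_eq_zero hd fun A B hA hB => ?_
  have hdA : Integrable d (((volume.restrict (Ioo 0 T)).restrict A).prod (volume.restrict Ω)) :=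
    hd.mono_measure (Measure.prod_mono Measure.restrict_le_self le_rfl)
  -- The exceptional times in `h1` depend on $\psi$. Integrating over $A$ first removes them, so the
  -- fundamental lemma applies in $x$ without a countable dense family of test functions.
  have h6 : ∀ᵐ x ∂(volume.restrict Ω), ∫ t in A, d (t, x) ∂(volume.restrict (Ioo 0 T)) = 0 := by
    have hz : ∀ᵐ x, x ∈ Ω → ∫ t in A, d (t, x) ∂(volume.restrict (Ioo 0 T)) = 0 := by
      refine hΩ.ae_eq_zero_of_integral_contDiff_smul_eq_zero
        (IntegrableOn.locallyIntegrableOn hdA.integral_prod_right) fun ψ h2 h3 h4 => ?_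
      have hψ : IsTestFunction Ω ψ := ⟨h2, h3, h4⟩
      have hiA : Integrable (fun z : ℝ × EuclideanSpace ℝ (Fin N) => d z * ψ z.2)
          (((volume.restrict (Ioo 0 T)).restrict A).prod (volume.restrict Ω)) :=
        (hψi hψ).mono_measure (Measure.prod_mono Measure.restrict_le_self le_rfl)
      rw [← setIntegral_eq_integral_of_forall_compl_eq_zero (s := Ω)]
      · have e : ∫ x in Ω, ψ x • ∫ t in A, d (t, x) ∂(volume.restrict (Ioo 0 T)) =
            ∫ x in Ω, ∫ t in A, d (t, x) * ψ x ∂(volume.restrict (Ioo 0 T)) := by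
          refine integral_congr_ae (Eventually.of_forall fun x => ?_)
          simp only [smul_eq_mul]
          rw [integral_mul_const, mul_comm]
        rw [e, ← integral_prod_symm _ hiA, integral_prod _ hiA]
        refine integral_eq_zero_of_ae ?_
        filter_upwards [ae_restrict_of_ae (h1 hψ)] with t ht
        exact ht
      · intro x hx
        rw [image_eq_zero_of_notMem_tsupport (fun h' => hx (h4 h')), zero_smul]
    exact (ae_restrict_iff' hΩ.measurableSet).2 hz
  rw [← Measure.prod_restrict]
  have hdAB : Integrable d (((volume.restrict (Ioo 0 T)).restrict A).prod
      ((volume.restrict Ω).restrict B)) :=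
    hd.mono_measure (Measure.prod_mono Measure.restrict_le_self Measure.restrict_le_self)
  rw [integral_prod_symm _ hdAB]
  refine integral_eq_zero_of_ae ?_
  filter_upwards [ae_restrict_of_ae h6] with x hx
  exact hx

end WeakDerivative

/-! ### Integrated chain rules, Steklov averages and the increment inequality. -/

section

variable {X : Type*} [MeasurableSpace X] {ν : Measure X} {u₀ : X → ℝ} {W h : ℝ × X → ℝ} {T : ℝ}

/-- For almost every $x$ the path is continuous in $t$ and the bound holds on a dense set of times,
hence on all of $[0,T]$. This makes the bound usable at each fixed time, including $t=0$. -/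
theorem ae_forall_abs_evolution_le [SFinite ν] (hT : 0 < T) (hWi : Integrable W (volume.prod ν))
    {M : ℝ} (hM : ∀ᵐ z ∂((volume.restrict (Ioo 0 T)).prod ν), |evolution u₀ W z.1 z.2| ≤ M) :
    ∀ᵐ x ∂ν, ∀ t ∈ Icc 0 T, |evolution u₀ W t x| ≤ M := by
  have h1 := Measure.ae_ae_of_ae_prod
    (Measure.measurePreserving_swap.quasiMeasurePreserving.ae hM :
      ∀ᵐ z ∂(ν.prod (volume.restrict (Ioo 0 T))), |evolution u₀ W z.2 z.1| ≤ M)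
  filter_upwards [h1, ae_integrable_slice hWi] with x hx hi
  have hc : Continuous fun t => evolution u₀ W t x :=
    continuous_const.add (intervalIntegral.continuous_primitive (fun a b => hi.intervalIntegrable) 0)
  rw [ae_restrict_iff' measurableSet_Ioo] at hx
  have hd := Measure.dense_of_ae hx
  have hcl : IsClosed {t | |evolution u₀ W t x| ≤ M} := isClosed_le hc.abs continuous_const
  have h2 : Ioo 0 T ∩ {t | t ∈ Ioo 0 T → |evolution u₀ W t x| ≤ M} ⊆
      {t | |evolution u₀ W t x| ≤ M} := fun t ht => ht.2 ht.1
  have h3 := closure_minimal (hd.open_subset_closure_inter isOpen_Ioo)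
    isClosed_closure |>.trans (closure_minimal h2 hcl)
  rw [closure_Ioo hT.ne] at h3
  exact fun t ht => h3 ht

/-- Integrated chain rule along an evolution. -/
theorem integral_comp_evolution_mul [IsFiniteMeasure ν] {F f : ℝ → ℝ}
    (hF : ∀ y, HasDerivAt F (f y) y) (hf : Continuous f)
    (hWi : Integrable W (volume.prod ν)) {b : ℝ} (hb : 0 ≤ b)
    (hi : Integrable (fun z : ℝ × X => f (evolution u₀ W z.1 z.2) * W z)
      ((volume.restrict (Ioo 0 b)).prod ν))
    (hFb : Integrable (fun x => F (evolution u₀ W b x)) ν) (hF0 : Integrable (fun x => F (u₀ x)) ν) :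
    ∫ z, f (evolution u₀ W z.1 z.2) * W z ∂((volume.restrict (Ioo 0 b)).prod ν) =
      (∫ x, F (evolution u₀ W b x) ∂ν) - ∫ x, F (u₀ x) ∂ν := by
  rw [integral_prod_symm _ hi, ← integral_sub hFb hF0]
  refine integral_congr_ae ?_
  filter_upwards [ae_integrable_slice hWi] with x hx
  rw [← integral_Ioc_eq_integral_Ioo, ← intervalIntegral.integral_of_le hb]
  exact integral_comp_mul_eq_sub hF hf hx.intervalIntegrable

theorem integral_weight_comp_evolution_mul_le [IsFiniteMeasure ν] {F f : ℝ → ℝ}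
    (hF : ∀ y, HasDerivAt F (f y) y) (hFn : ∀ y, 0 ≤ F y) (hf : Continuous f)
    (hWi : Integrable W (volume.prod ν)) {b : ℝ} (hb : 0 ≤ b)
    {ζ : ℝ → ℝ} (hζ : ContDiffOn ℝ 1 ζ (Ici 0)) (hζ' : ∀ t, 0 ≤ t → 0 ≤ derivWithin ζ (Ici 0) t)
    (hi : Integrable (fun z : ℝ × X => ζ z.1 * (f (evolution u₀ W z.1 z.2) * W z))
      ((volume.restrict (Ioo 0 b)).prod ν))
    (hFb : Integrable (fun x => F (evolution u₀ W b x)) ν) (hF0 : Integrable (fun x => F (u₀ x)) ν) :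
    ∫ z, ζ z.1 * (f (evolution u₀ W z.1 z.2) * W z) ∂((volume.restrict (Ioo 0 b)).prod ν) ≤
      ζ b * (∫ x, F (evolution u₀ W b x) ∂ν) - ζ 0 * ∫ x, F (u₀ x) ∂ν := by
  rw [integral_prod_symm _ hi, ← integral_const_mul, ← integral_const_mul,
    ← integral_sub (hFb.const_mul _) (hF0.const_mul _)]
  refine integral_mono_ae hi.integral_prod_right ((hFb.const_mul _).sub (hF0.const_mul _)) ?_
  filter_upwards [ae_integrable_slice hWi] with x hx
  rw [← integral_Ioc_eq_integral_Ioo, ← intervalIntegral.integral_of_le hb]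
  exact integral_weight_comp_mul_le hF hFn hf hx.intervalIntegrable hb hζ hζ'

section Steklov

/-- The integral of `W` over the time interval `(r - δ, r)`. -/
def backwardIntegral (W : ℝ × X → ℝ) (δ : ℝ) (z : ℝ × X) : ℝ := ∫ s in (z.1 - δ)..z.1, W (s, z.2)

theorem stronglyMeasurable_backwardIntegral (hW : StronglyMeasurable W) {δ : ℝ} (hδ : 0 ≤ δ) :
    StronglyMeasurable (backwardIntegral W δ) := by
  have e : backwardIntegral W δ = fun z : ℝ × X =>
      ∫ η, W (z.1 - η, z.2) ∂(volume.restrict (Ioc 0 δ)) := by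
    ext z
    rw [← intervalIntegral.integral_of_le hδ,
      intervalIntegral.integral_comp_sub_left (fun s => W (s, z.2)), sub_zero]
    rfl
  rw [e]
  have hm : StronglyMeasurable fun q : (ℝ × X) × ℝ => W (q.1.1 - q.2, q.1.2) :=
    hW.comp_measurable (by fun_prop)
  exact hm.integral_prod_right'

variable [SFinite ν]

theorem integrable_mul_backwardIntegral (hW : StronglyMeasurable W)
    (hW2 : MemLp W 2 (volume.prod ν)) (hh : StronglyMeasurable h)
    (hh2 : MemLp h 2 (volume.prod ν)) {δ : ℝ} (hδ : 0 < δ) :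
    Integrable (fun z => h z * backwardIntegral W δ z) (volume.prod ν) := by
  have hm : AEStronglyMeasurable (fun z => h z * backwardIntegral W δ z) (volume.prod ν) :=
    (hh.mul (stronglyMeasurable_backwardIntegral hW hδ.le)).aestronglyMeasurable
  have hsl := memLp_two_slice hW hW2
  have hsl' := memLp_two_slice hh hh2
  rw [integrable_prod_iff' hm]
  constructor
  · filter_upwards [hsl, hsl'] with x h1 h2
    exact integrable_mul_integral h2 h1 δ
  · have hI : Integrable (fun x => δ * ((∫ r, h (r, x) ^ 2) + ∫ r, W (r, x) ^ 2)) ν :=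
      ((hh2.integrable_sq.integral_prod_right).add (hW2.integrable_sq.integral_prod_right)).const_mul δ
    refine hI.mono' (hm.norm.prod_swap.integral_prod_right') ?_
    filter_upwards [hsl, hsl'] with x h1 h2
    rw [Real.norm_of_nonneg (by positivity)]
    -- Applied to absolute values, since integrability requires $\int|h|\int|W|$ and not merely the
    -- signed pairing.
    have h3 := abs_integral_mul_average_le h2.norm h1.norm hδ
    rw [abs_mul, abs_of_pos (inv_pos.2 hδ), inv_mul_le_iff₀ hδ] at h3
    simp only [Real.norm_eq_abs, sq_abs] at h3
    refine le_trans ?_ ((le_abs_self _).trans h3)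
    refine integral_mono_of_nonneg (Eventually.of_forall fun _ => norm_nonneg _) ?_
      (Eventually.of_forall fun r => ?_)
    · exact integrable_mul_integral h2.norm h1.norm δ
    · simp only [norm_mul, Real.norm_eq_abs, backwardIntegral]
      refine mul_le_mul_of_nonneg_left ?_ (abs_nonneg _)
      exact intervalIntegral.abs_integral_le_integral_abs (by linarith)

/-- The one-dimensional convergence holds on almost every fibre, and the majorant $\int h^2+\int
W^2$, uniform in $\delta$, allows dominated convergence in $x$. -/
theorem tendsto_integral_mul_backwardIntegral (hW : StronglyMeasurable W)
    (hW2 : MemLp W 2 (volume.prod ν)) (hh : StronglyMeasurable h)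
    (hh2 : MemLp h 2 (volume.prod ν)) :
    Tendsto (fun δ : ℝ => δ⁻¹ * ∫ z, h z * backwardIntegral W δ z ∂(volume.prod ν)) (𝓝[>] 0)
      (𝓝 (∫ z, h z * W z ∂(volume.prod ν))) := by
  have hsl := memLp_two_slice hW hW2
  have hsl' := memLp_two_slice hh hh2
  have hi : Integrable (fun z => h z * W z) (volume.prod ν) := hh2.integrable_mul hW2
  rw [integral_prod_symm _ hi]
  have hI : Integrable (fun x => (∫ r, h (r, x) ^ 2) + ∫ r, W (r, x) ^ 2) ν :=
      ((hh2.integrable_sq.integral_prod_right).add (hW2.integrable_sq.integral_prod_right))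
  have key : Tendsto (fun δ : ℝ => ∫ x, (δ⁻¹ * ∫ r, h (r, x) * backwardIntegral W δ (r, x)) ∂ν)
      (𝓝[>] 0) (𝓝 (∫ x, (∫ r, h (r, x) * W (r, x)) ∂ν)) := by
    refine tendsto_integral_filter_of_dominated_convergence _ ?_ ?_ hI ?_
    · filter_upwards [self_mem_nhdsWithin] with δ hδ
      exact ((integrable_mul_backwardIntegral hW hW2 hh hh2 hδ).integral_prod_right.const_mul _).1
    · filter_upwards [self_mem_nhdsWithin] with δ hδ
      filter_upwards [hsl, hsl'] with x h1 h2
      exact abs_integral_mul_average_le h2 h1 hδ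
    · filter_upwards [hsl, hsl'] with x h1 h2
      exact tendsto_integral_mul_average h2 h1
  refine key.congr' ?_
  filter_upwards [self_mem_nhdsWithin] with δ hδ
  rw [integral_prod_symm _ (integrable_mul_backwardIntegral hW hW2 hh hh2 hδ), integral_const_mul]

end Steklov

/-- If at almost every time `r` the increments of `Φ` ending at `r` are bounded by the pairing of
`h r` with the increments of the curve, then `Φ b - Φ 0` is at most the integral of the pairing of
`h` with the time derivative. -/
theorem ae_sub_le_integral_of_increment_le [IsFiniteMeasure ν] (hW : StronglyMeasurable W)
    (hW2 : MemLp W 2 (volume.prod ν)) (hWi : Integrable W (volume.prod ν))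
    (hW0 : ∀ t ≤ 0, ∀ x, W (t, x) = 0) (hh : StronglyMeasurable h)
    (hh2 : MemLp h 2 (volume.prod ν)) {Φ : ℝ → ℝ} {Φ₀ : ℝ} (hΦ : IntegrableOn Φ (Ioo 0 T))
    {S : Set ℝ} (hS : ∀ᵐ t ∂(volume.restrict (Ioo 0 T)), t ∈ S)
    (h0 : ∀ r ∈ S, Φ r - Φ₀ ≤ ∫ x, h (r, x) * (evolution u₀ W r x - u₀ x) ∂ν)
    (h1 : ∀ r ∈ S, ∀ s ∈ S,
      Φ r - Φ s ≤ ∫ x, h (r, x) * (evolution u₀ W r x - evolution u₀ W s x) ∂ν) :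
    ∀ᵐ b ∂(volume.restrict (Ioo 0 T)),
      Φ b - Φ₀ ≤ ∫ z, h z * W z ∂((volume.restrict (Ioo 0 b)).prod ν) := by
  have hS' : ∀ᵐ t, t ∈ Ioo 0 T → t ∈ S := (ae_restrict_iff' measurableSet_Ioo).1 hS
  have hsl := ae_integrable_slice hWi
  have hinc (a b : ℝ) : ∀ᵐ x ∂ν,
      evolution u₀ W b x - evolution u₀ W a x = ∫ s in a..b, W (s, x) := by
    filter_upwards [hsl] with x hx
    simp only [evolution, add_sub_add_left_eq_sub]
    exact intervalIntegral.integral_interval_sub_left hx.intervalIntegrable hx.intervalIntegrable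
  -- Since $W$ vanishes at nonpositive times, the curve is extended to negative times by $u_0$;
  -- increments reaching below $0$ are therefore increments from $u_0$.
  have hneg {a : ℝ} (ha : a ≤ 0) (x : X) : evolution u₀ W a x = u₀ x := by
    simp only [evolution, add_eq_left]
    refine intervalIntegral.integral_zero_ae (Eventually.of_forall fun s hs => hW0 s ?_ x)
    rw [uIoc_of_ge ha] at hs
    exact hs.2
  rw [ae_restrict_iff' measurableSet_Ioo]
  rcases le_or_gt T 0 with hT | hT
  · exact Eventually.of_forall fun b hb => absurd (hb.1.trans hb.2) (not_lt.2 hT)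
  have hΦI : IntervalIntegrable Φ volume 0 T := by
    rw [intervalIntegrable_iff_integrableOn_Ioo_of_le hT.le]; exact hΦ
  -- Only times $b$ at which the primitive of $\Phi$ has derivative $\Phi(b)$ are kept: there the
  -- backward averages of $\Phi$ converge to $\Phi(b)$.
  filter_upwards [hΦI.ae_hasDerivAt_integral] with b hb hbT
  have hb' := hb (by rw [uIcc_of_le hT.le]; exact Ioo_subset_Icc_self hbT) 0 (by simp)
  -- Cutting $h$ off to $(0,b)$ allows the Steklov limit to be taken over the whole time line.
  set hb₀ : ℝ × X → ℝ := (Ioo 0 b ×ˢ univ).indicator h with hb₀_def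
  have hmb : MeasurableSet (Ioo 0 b ×ˢ (univ : Set X)) := measurableSet_Ioo.prod MeasurableSet.univ
  have hbm : StronglyMeasurable hb₀ := hh.indicator hmb
  have hb2 : MemLp hb₀ 2 (volume.prod ν) := hh2.indicator hmb
  have hprod : (volume.prod ν).restrict (Ioo 0 b ×ˢ (univ : Set X)) =
      (volume.restrict (Ioo 0 b)).prod ν := by
    rw [← Measure.prod_restrict, Measure.restrict_univ]
  have hlim := tendsto_integral_mul_backwardIntegral hW hW2 hbm hb2
  have e1 : ∫ z, hb₀ z * W z ∂(volume.prod ν) =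
      ∫ z, h z * W z ∂((volume.restrict (Ioo 0 b)).prod ν) := by
    rw [← hprod, ← integral_indicator hmb]
    refine integral_congr_ae (Eventually.of_forall fun z => ?_)
    simp only [hb₀, indicator_mul_left]
  rw [e1] at hlim
  have hleft : Tendsto (fun δ : ℝ => δ⁻¹ * (∫ s in (b - δ)..b, Φ s) - Φ₀) (𝓝[>] 0)
      (𝓝 (Φ b - Φ₀)) := by
    refine Tendsto.sub_const ?_ _
    have hs := hb'.tendsto_slope_zero_left
    have hn : Tendsto (fun δ : ℝ => -δ) (𝓝[>] 0) (𝓝[<] 0) := by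
      have := tendsto_neg_nhdsGT (a := (0 : ℝ))
      simpa using this
    refine (hs.comp hn).congr' ?_
    filter_upwards [Ioo_mem_nhdsGT hbT.1] with δ hδ
    have i0 : IntervalIntegrable Φ volume 0 b :=
      hΦI.mono_set (by rw [uIcc_of_le hbT.1.le, uIcc_of_le hT.le]; exact Icc_subset_Icc_right hbT.2.le)
    have i1 : IntervalIntegrable Φ volume 0 (b - δ) :=
      i0.mono_set (by
        rw [uIcc_of_le hbT.1.le, uIcc_of_le (by linarith [hδ.2])]
        exact Icc_subset_Icc_right (by linarith [hδ.1]))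
    simp only [Function.comp, smul_eq_mul]
    rw [← sub_eq_add_neg, ← intervalIntegral.integral_interval_sub_left i0 i1, inv_neg]
    ring
  refine le_of_tendsto_of_tendsto hleft hlim ?_
  filter_upwards [Ioo_mem_nhdsGT hbT.1] with δ hδ
  obtain ⟨hδ0, hδb⟩ := hδ
  have hk := integrable_mul_backwardIntegral hW hW2 hbm hb2 hδ0
  set k : ℝ → ℝ := fun r => ∫ x, hb₀ (r, x) * backwardIntegral W δ (r, x) ∂ν with hk_def
  have hki : Integrable k := hk.integral_prod_left
  have hkeq {r : ℝ} (hr : r ∈ Ioo 0 b) : k r =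
      ∫ x, h (r, x) * (evolution u₀ W r x - evolution u₀ W (r - δ) x) ∂ν := by
    refine integral_congr_ae ?_
    filter_upwards [hinc (r - δ) r] with x hx
    rw [hx]
    simp only [hb₀, backwardIntegral]
    rw [indicator_of_mem (show (r, x) ∈ Ioo 0 b ×ˢ univ from ⟨hr, mem_univ _⟩)]
  have i0 : IntervalIntegrable Φ volume 0 b :=
    hΦI.mono_set (by rw [uIcc_of_le hbT.1.le, uIcc_of_le hT.le]; exact Icc_subset_Icc_right hbT.2.le)
  have iδ : IntervalIntegrable Φ volume 0 δ :=
    i0.mono_set (by rw [uIcc_of_le hbT.1.le, uIcc_of_le hδ0.le]; exact Icc_subset_Icc_right hδb.le)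
  have iδb : IntervalIntegrable Φ volume δ b :=
    i0.mono_set (by rw [uIcc_of_le hbT.1.le, uIcc_of_le hδb.le]; exact Icc_subset_Icc_left hδ0.le)
  have i1 : IntervalIntegrable Φ volume 0 (b - δ) :=
    i0.mono_set (by
      rw [uIcc_of_le hbT.1.le, uIcc_of_le (by linarith)]
      exact Icc_subset_Icc_right (by linarith))
  have i2 : IntervalIntegrable (fun r => Φ (r - δ)) volume δ b := by
    simpa using i1.comp_sub_right δ
  have n0 (c : ℝ) : ∀ᵐ r : ℝ, r ≠ c := by simp [ae_iff, measure_singleton]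
  have hshift : ∀ᵐ r, r - δ ∈ Ioo 0 T → r - δ ∈ S :=
    (measurePreserving_sub_const δ).quasiMeasurePreserving.ae hS'
  -- For $r<\delta$ the earlier time $r-\delta$ is negative and `h0` applies; for $r>\delta$ it is
  -- `h1` with $s=r-\delta$.
  have b1 : ∫ r in (0 : ℝ)..δ, (Φ r - Φ₀) ≤ ∫ r in (0 : ℝ)..δ, k r := by
    refine intervalIntegral.integral_mono_ae_restrict hδ0.le (iδ.sub (by simp))
      hki.intervalIntegrable ?_
    rw [Filter.EventuallyLE, ae_restrict_iff' measurableSet_Icc]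
    filter_upwards [hS', n0 0] with r hr1 hr2 hr
    have hr0 : 0 < r := lt_of_le_of_ne hr.1 (Ne.symm hr2)
    rw [hkeq ⟨hr0, hr.2.trans_lt hδb⟩]
    simp only [hneg (show r - δ ≤ 0 by linarith [hr.2])]
    exact h0 r (hr1 ⟨hr0, hr.2.trans_lt (hδb.trans hbT.2)⟩)
  have b2 : ∫ r in δ..b, (Φ r - Φ (r - δ)) ≤ ∫ r in δ..b, k r := by
    refine intervalIntegral.integral_mono_ae_restrict hδb.le (iδb.sub i2)
      hki.intervalIntegrable ?_
    rw [Filter.EventuallyLE, ae_restrict_iff' measurableSet_Icc]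
    filter_upwards [hS', hshift, n0 δ, n0 b] with r hr1 hr2 hr3 hr4 hr
    have hrδ : δ < r := lt_of_le_of_ne hr.1 (Ne.symm hr3)
    have hrb : r < b := lt_of_le_of_ne hr.2 hr4
    rw [hkeq ⟨hδ0.trans hrδ, hrb⟩]
    exact h1 r (hr1 ⟨hδ0.trans hrδ, hrb.trans hbT.2⟩) _
      (hr2 ⟨by linarith, by linarith [hbT.2]⟩)
  have b3 : (∫ r in (0 : ℝ)..δ, k r) + ∫ r in δ..b, k r =
      ∫ z, hb₀ z * backwardIntegral W δ z ∂(volume.prod ν) := by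
    rw [intervalIntegral.integral_add_adjacent_intervals hki.intervalIntegrable
      hki.intervalIntegrable, integral_prod _ hk, intervalIntegral.integral_of_le hbT.1.le,
      integral_Ioc_eq_integral_Ioo]
    refine setIntegral_eq_integral_of_forall_compl_eq_zero fun r hr => ?_
    refine integral_eq_zero_of_ae (Eventually.of_forall fun x => ?_)
    simp only [hb₀]
    rw [indicator_of_notMem (fun h' => hr h'.1), zero_mul]
    rfl
  rw [intervalIntegral.integral_sub iδ (by simp), intervalIntegral.integral_const, sub_zero,
    smul_eq_mul] at b1
  rw [intervalIntegral.integral_sub iδb i2, intervalIntegral.integral_comp_sub_right, sub_self] at b2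
  -- Telescoping: $\int_0^\delta\Phi+\int_\delta^b\Phi-\int_0^{b-\delta}\Phi=\int_{b-\delta}^b\Phi$.
  have b4 := intervalIntegral.integral_add_adjacent_intervals iδ iδb
  have b5 := intervalIntegral.integral_interval_sub_left i0 i1
  rw [← b3, ← mul_inv_cancel_left₀ hδ0.ne' Φ₀, ← b5]
  rw [show δ * (δ⁻¹ * Φ₀) = δ⁻¹ * (δ * Φ₀) by ring, ← mul_sub]
  refine mul_le_mul_of_nonneg_left ?_ (inv_pos.2 hδ0).le
  linarith

end

/-! ### Time regularity of weak solutions, the energy inequality and the $L^2$ identity. -/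

section

variable {N : ℕ} {Ω : Set (EuclideanSpace ℝ (Fin N))} {p κ : ℝ} {ζ f : ℝ → ℝ}
  {u₀ : EuclideanSpace ℝ (Fin N) → ℝ}
  {G₀ : EuclideanSpace ℝ (Fin N) → EuclideanSpace ℝ (Fin N)} {T : ℝ}
  {u : ℝ → EuclideanSpace ℝ (Fin N) → ℝ}
  {G : ℝ → EuclideanSpace ℝ (Fin N) → EuclideanSpace ℝ (Fin N)}
  {w : ℝ → EuclideanSpace ℝ (Fin N) → ℝ}

theorem exists_bound_comp_of_continuous {g : ℝ → ℝ} (hg : Continuous g) (M : ℝ) :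
    ∃ C, 0 ≤ C ∧ ∀ y, |y| ≤ M → |g y| ≤ C := by
  obtain ⟨C, hC⟩ := (isCompact_Icc (a := -M) (b := M)).exists_bound_of_continuousOn hg.continuousOn
  exact ⟨max C 0, le_max_right _ _, fun y hy => (hC y (abs_le.1 hy)).trans (le_max_left _ _)⟩

theorem memLp_comp_of_bounded {X : Type*} [MeasurableSpace X] {μ : Measure X} [IsFiniteMeasure μ]
    {g : ℝ → ℝ} (hg : Continuous g) {M : ℝ} {v : X → ℝ} (hv : AEStronglyMeasurable v μ)
    (hM : ∀ᵐ x ∂μ, |v x| ≤ M) (q : ℝ≥0∞) : MemLp (fun x => g (v x)) q μ := by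
  obtain ⟨C, -, hC⟩ := exists_bound_comp_of_continuous hg M
  refine MemLp.of_bound (hg.comp_aestronglyMeasurable hv) C ?_
  filter_upwards [hM] with x hx
  exact hC _ hx

/-- A weak time derivative is a time derivative: the solution is an evolution. -/
theorem IsWeakSolution.exists_evolution (hΩ : IsOpen Ω) [IsFiniteMeasure (volume.restrict Ω)]
    (hT : 0 < T) (hu₀ : MemLp u₀ ∞ (volume.restrict Ω))
    (hs : IsWeakSolution Ω p ζ f u₀ T u G w) :
    ∃ W : ℝ × EuclideanSpace ℝ (Fin N) → ℝ, StronglyMeasurable W ∧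
      MemLp W 2 (volume.prod (volume.restrict Ω)) ∧
      Integrable W (volume.prod (volume.restrict Ω)) ∧ (∀ t ≤ 0, ∀ x, W (t, x) = 0) ∧
      Function.uncurry w =ᵐ[(volume.restrict (Ioo 0 T)).prod (volume.restrict Ω)] W ∧
      Function.uncurry u =ᵐ[(volume.restrict (Ioo 0 T)).prod (volume.restrict Ω)]
        Function.uncurry (evolution u₀ W) := by
  have hw := hs.deriv_memLp
  have hub := hs.bounded
  rw [volume_restrict_cylinder] at hw hub
  have hmT : MeasurableSet (Ioo 0 T ×ˢ (univ : Set (EuclideanSpace ℝ (Fin N)))) :=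
    measurableSet_Ioo.prod MeasurableSet.univ
  have hprod : (volume.prod (volume.restrict Ω)).restrict
      (Ioo 0 T ×ˢ (univ : Set (EuclideanSpace ℝ (Fin N)))) =
      (volume.restrict (Ioo 0 T)).prod (volume.restrict Ω) := by
    rw [← Measure.prod_restrict, Measure.restrict_univ]
  obtain ⟨g, hgm, hg⟩ := hw.1
  set W : ℝ × EuclideanSpace ℝ (Fin N) → ℝ :=
    (Ioo 0 T ×ˢ (univ : Set (EuclideanSpace ℝ (Fin N)))).indicator g with hWdef
  have hWm : StronglyMeasurable W := hgm.indicator hmT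
  have hWae : Function.uncurry w =ᵐ[(volume.restrict (Ioo 0 T)).prod (volume.restrict Ω)] W := by
    refine hg.trans ?_
    rw [← hprod]
    exact (indicator_ae_eq_restrict hmT).symm
  have hW2 : MemLp W 2 (volume.prod (volume.restrict Ω)) := by
    rw [hWdef, memLp_indicator_iff_restrict hmT, hprod]
    exact (memLp_congr_ae hg).1 hw
  have hWi : Integrable W (volume.prod (volume.restrict Ω)) := by
    rw [hWdef, integrable_indicator_iff hmT, IntegrableOn, hprod]
    exact ((memLp_congr_ae hg).1 hw).integrable (by norm_num)
  refine ⟨W, hWm, hW2, hWi, fun t ht x => indicator_of_notMem (fun h => ?_) _, hWae, ?_⟩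
  · exact absurd h.1.1 (not_lt.2 ht)
  have hu₀i : Integrable u₀ (volume.restrict Ω) := hu₀.integrable (by simp)
  have hVi := integrable_evolution hWm hWi hu₀i (volume.restrict (Ioo 0 T))
  have hui : Integrable (Function.uncurry u)
      ((volume.restrict (Ioo 0 T)).prod (volume.restrict Ω)) := hub.integrable (by simp)
  have hd := ae_eq_zero_of_forall_tensor hΩ (hui.sub hVi) fun η ψ hη hψ => ?_
  · filter_upwards [hd] with z hz
    exact sub_eq_zero.1 hz
  · obtain ⟨θ, hθ, hθη⟩ := exists_primitive_isTestFunction hη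
    have h1 := hs.deriv_initial _ (hθ.prod hψ)
    have h2 := integral_evolution_mul_deriv hT hWm hWi hu₀i hθ hψ
    have hdθ : Differentiable ℝ θ := hθ.1.differentiable (by simp)
    simp only [fun z : ℝ × EuclideanSpace ℝ (Fin N) =>
      deriv_mul_const (hdθ z.1) (ψ z.2)] at h1
    rw [volume_restrict_cylinder] at h1 h2
    have e1 : ∫ z, w z.1 z.2 * (θ z.1 * ψ z.2)
        ∂((volume.restrict (Ioo 0 T)).prod (volume.restrict Ω)) = ∫ z, W z * (θ z.1 * ψ z.2)
        ∂((volume.restrict (Ioo 0 T)).prod (volume.restrict Ω)) := by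
      refine integral_congr_ae ?_
      filter_upwards [hWae] with z hz
      rw [← hz]; rfl
    rw [e1, ← h2] at h1
    -- The solution and the evolution satisfy the same integration by parts with the same initial
    -- term, so their difference is orthogonal to $\theta'\otimes\psi$, which equals
    -- $\eta\otimes\psi$ on the cylinder.
    have h3 := add_right_cancel h1
    have hae : ∀ᵐ z ∂((volume.restrict (Ioo 0 T)).prod (volume.restrict Ω)),
        deriv θ z.1 = η z.1 :=
      Measure.quasiMeasurePreserving_fst.ae
        ((ae_restrict_iff' measurableSet_Ioo).2 (Eventually.of_forall hθη))
    obtain ⟨C, hC⟩ := hψ.exists_bound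
    obtain ⟨D, hD⟩ := hη.exists_bound
    have hψc := hψ.1.continuous
    have hηc := hη.1.continuous
    have hb {v : ℝ × EuclideanSpace ℝ (Fin N) → ℝ}
        (hv : Integrable v ((volume.restrict (Ioo 0 T)).prod (volume.restrict Ω))) :
        Integrable (fun z => v z * (η z.1 * ψ z.2))
          ((volume.restrict (Ioo 0 T)).prod (volume.restrict Ω)) := by
      refine hv.mul_bdd (c := D * C)
        (Continuous.aestronglyMeasurable (by fun_prop)) (Eventually.of_forall fun z => ?_)
      rw [norm_mul]
      exact mul_le_mul (hD _) (hC _) (norm_nonneg _) ((norm_nonneg _).trans (hD 0))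
    have e2 (v : ℝ × EuclideanSpace ℝ (Fin N) → ℝ) :
        ∫ z, v z * (deriv θ z.1 * ψ z.2)
          ∂((volume.restrict (Ioo 0 T)).prod (volume.restrict Ω)) =
        ∫ z, v z * (η z.1 * ψ z.2)
          ∂((volume.restrict (Ioo 0 T)).prod (volume.restrict Ω)) := by
      refine integral_congr_ae ?_
      filter_upwards [hae] with z hz
      rw [hz]
    have h4 := e2 (Function.uncurry u)
    have h5 := e2 (Function.uncurry (evolution u₀ W))
    simp only [Pi.sub_apply, sub_mul]
    rw [integral_sub (hb hui) (hb hVi), ← h4, ← h5, sub_eq_zero]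
    exact h3

/-- Regularity in time of a weak solution: `W` is a representative of the time derivative, `H` is a
representative of `ζ f(u) - u_t`, and `M` bounds the solution. -/
structure TimeRegular (Ω : Set (EuclideanSpace ℝ (Fin N))) (p : ℝ) (ζ f : ℝ → ℝ)
    (u₀ : EuclideanSpace ℝ (Fin N) → ℝ) (T : ℝ)
    (u : ℝ → EuclideanSpace ℝ (Fin N) → ℝ)
    (G : ℝ → EuclideanSpace ℝ (Fin N) → EuclideanSpace ℝ (Fin N))
    (w : ℝ → EuclideanSpace ℝ (Fin N) → ℝ) (W H : ℝ × EuclideanSpace ℝ (Fin N) → ℝ)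
    (M : ℝ) : Prop where
  measurable_deriv : StronglyMeasurable W
  memLp_deriv : MemLp W 2 (volume.prod (volume.restrict Ω))
  integrable_deriv : Integrable W (volume.prod (volume.restrict Ω))
  deriv_eq_zero : ∀ t ≤ 0, ∀ x, W (t, x) = 0
  deriv_ae : Function.uncurry w =ᵐ[(volume.restrict (Ioo 0 T)).prod (volume.restrict Ω)] W
  bound : ∀ᵐ x ∂(volume.restrict Ω), ∀ t ∈ Icc 0 T, |evolution u₀ W t x| ≤ M
  measurable_rhs : StronglyMeasurable H
  memLp_rhs : MemLp H 2 (volume.prod (volume.restrict Ω))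
  rhs_ae : ∀ᵐ z ∂((volume.restrict (Ioo 0 T)).prod (volume.restrict Ω)),
    H z = ζ z.1 * f (evolution u₀ W z.1 z.2) - W z
  slice : ∀ᵐ t ∂(volume.restrict (Ioo 0 T)), MemW0 Ω p (u t) (G t) ∧
    MemLp (fun x => W (t, x)) 2 (volume.restrict Ω) ∧
    MemLp (fun x => H (t, x)) 2 (volume.restrict Ω) ∧
    u t =ᵐ[volume.restrict Ω] evolution u₀ W t ∧
    (∀ᵐ x ∂(volume.restrict Ω), H (t, x) = ζ t * f (evolution u₀ W t x) - W (t, x)) ∧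
    ∀ φ : EuclideanSpace ℝ (Fin N) → ℝ, IsTestFunction Ω φ →
      (∫ x in Ω, inner ℝ (‖G t x‖ ^ (p - 2) • G t x) (gradient φ x)) = ∫ x in Ω, H (t, x) * φ x

theorem memLp_weight_mul (hζ : ContDiffOn ℝ 1 ζ (Ici 0)) {X : Type*} [MeasurableSpace X]
    {ν : Measure X} [IsFiniteMeasure ν] {v : ℝ × X → ℝ} {q : ℝ≥0∞}
    (hv : MemLp v q ((volume.restrict (Ioo 0 T)).prod ν)) :
    MemLp (fun z => ζ z.1 * v z) q ((volume.restrict (Ioo 0 T)).prod ν) := by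
  obtain ⟨C, hC⟩ := (isCompact_Icc (a := (0 : ℝ)) (b := T)).exists_bound_of_continuousOn
    (hζ.continuousOn.mono Icc_subset_Ici_self)
  have hm : AEStronglyMeasurable ζ (volume.restrict (Ioo 0 T)) :=
    (hζ.continuousOn.mono (Ioo_subset_Icc_self.trans Icc_subset_Ici_self)).aestronglyMeasurable
      measurableSet_Ioo
  refine hv.of_le_mul (c := C) (hm.comp_fst.mul hv.1) ?_
  have h1 : ∀ᵐ z ∂((volume.restrict (Ioo 0 T)).prod ν), z.1 ∈ Ioo 0 T :=
    Measure.quasiMeasurePreserving_fst.ae (ae_restrict_mem measurableSet_Ioo)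
  filter_upwards [h1] with z hz
  rw [norm_mul]
  exact mul_le_mul_of_nonneg_right (hC _ (Ioo_subset_Icc_self hz)) (norm_nonneg _)

/-- With $u_t$ moved to the right, the equation at almost every time reads $-\Delta_p u(t)=H(t)$
with $H(t)\in L^2$, which is the form needed to test with $W_0^{1,p}$. -/
theorem IsWeakSolution.exists_timeRegular (hΩ : IsOpen Ω) [IsFiniteMeasure (volume.restrict Ω)]
    (hT : 0 < T) (hu₀ : MemLp u₀ ∞ (volume.restrict Ω)) (hζ : ContDiffOn ℝ 1 ζ (Ici 0))
    (hf : Continuous f) (hs : IsWeakSolution Ω p ζ f u₀ T u G w) :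
    ∃ W H M, TimeRegular Ω p ζ f u₀ T u G w W H M := by
  obtain ⟨W, hWm, hW2, hWi, hW0, hWae, huae⟩ := hs.exists_evolution hΩ hT hu₀
  have hub := hs.bounded
  rw [volume_restrict_cylinder] at hub
  have hM : ∀ᵐ z ∂((volume.restrict (Ioo 0 T)).prod (volume.restrict Ω)),
      |evolution u₀ W z.1 z.2| ≤ (eLpNorm (Function.uncurry u) ∞
        ((volume.restrict (Ioo 0 T)).prod (volume.restrict Ω))).toReal := by
    have h1 := enorm_ae_le_eLpNormEssSup (Function.uncurry u)
      ((volume.restrict (Ioo 0 T)).prod (volume.restrict Ω))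
    rw [← eLpNorm_exponent_top] at h1
    filter_upwards [h1, huae] with z hz hz2
    have h3 := ENNReal.toReal_mono hub.2.ne hz
    rw [hz2, toReal_enorm] at h3
    exact h3
  have hMx := ae_forall_abs_evolution_le hT hWi hM
  have hmT : MeasurableSet (Ioo 0 T ×ˢ (univ : Set (EuclideanSpace ℝ (Fin N)))) :=
    measurableSet_Ioo.prod MeasurableSet.univ
  have hprod : (volume.prod (volume.restrict Ω)).restrict
      (Ioo 0 T ×ˢ (univ : Set (EuclideanSpace ℝ (Fin N)))) =
      (volume.restrict (Ioo 0 T)).prod (volume.restrict Ω) := by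
    rw [← Measure.prod_restrict, Measure.restrict_univ]
  have hVm := aestronglyMeasurable_evolution hWm hu₀.1 (volume.restrict (Ioo 0 T))
  have hfV := memLp_comp_of_bounded hf hVm hM 2
  have hW2' : MemLp W 2 ((volume.restrict (Ioo 0 T)).prod (volume.restrict Ω)) :=
    hW2.mono_measure (Measure.prod_mono Measure.restrict_le_self le_rfl)
  have hh : MemLp (fun z => ζ z.1 * f (evolution u₀ W z.1 z.2) - W z) 2
      ((volume.restrict (Ioo 0 T)).prod (volume.restrict Ω)) := (memLp_weight_mul hζ hfV).sub hW2'
  obtain ⟨g, hgm, hg⟩ := hh.1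
  set H : ℝ × EuclideanSpace ℝ (Fin N) → ℝ :=
    (Ioo 0 T ×ˢ (univ : Set (EuclideanSpace ℝ (Fin N)))).indicator g with hHdef
  have hHm : StronglyMeasurable H := hgm.indicator hmT
  have hHae : ∀ᵐ z ∂((volume.restrict (Ioo 0 T)).prod (volume.restrict Ω)),
      H z = ζ z.1 * f (evolution u₀ W z.1 z.2) - W z := by
    refine EventuallyEq.trans ?_ hg.symm
    rw [← hprod]
    exact indicator_ae_eq_restrict hmT
  have hH2 : MemLp H 2 (volume.prod (volume.restrict Ω)) := by
    rw [hHdef, memLp_indicator_iff_restrict hmT, hprod]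
    exact (memLp_congr_ae hg).1 hh
  have hH2' : MemLp H 2 ((volume.restrict (Ioo 0 T)).prod (volume.restrict Ω)) :=
    hH2.mono_measure (Measure.prod_mono Measure.restrict_le_self le_rfl)
  refine ⟨W, H, _, hWm, hW2, hWi, hW0, hWae, hMx, hHm, hH2, hHae, ?_⟩
  filter_upwards [hs.memW0, hs.equation, hW2'.integrable_sq.prod_right_ae,
    hH2'.integrable_sq.prod_right_ae, Measure.ae_ae_of_ae_prod huae, Measure.ae_ae_of_ae_prod hWae,
    Measure.ae_ae_of_ae_prod hHae, Measure.ae_ae_of_ae_prod hM] with t h1 h2 h3 h4 h5 h6 h7 h8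
  have hWt : MemLp (fun x => W (t, x)) 2 (volume.restrict Ω) := (memLp_two_iff_integrable_sq
    (hWm.comp_measurable measurable_prodMk_left).aestronglyMeasurable).2 h3
  have hHt : MemLp (fun x => H (t, x)) 2 (volume.restrict Ω) := (memLp_two_iff_integrable_sq
    (hHm.comp_measurable measurable_prodMk_left).aestronglyMeasurable).2 h4
  have h5' : u t =ᵐ[volume.restrict Ω] evolution u₀ W t := h5
  refine ⟨h1, hWt, hHt, h5', h7, fun φ hφ => ?_⟩
  have hft := memLp_comp_of_bounded hf (aestronglyMeasurable_evolution_slice hWm hu₀.1 t) h8 2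
  have h9 := h2 φ hφ
  have e1 : ∫ x in Ω, w t x * φ x = ∫ x in Ω, W (t, x) * φ x := by
    refine integral_congr_ae ?_
    filter_upwards [h6] with x hx
    rw [← hx]; rfl
  have e2 : ∫ x in Ω, f (u t x) * φ x = ∫ x in Ω, f (evolution u₀ W t x) * φ x := by
    refine integral_congr_ae ?_
    filter_upwards [h5'] with x hx
    rw [hx]
  have e3 : ∫ x in Ω, H (t, x) * φ x =
      ∫ x in Ω, (ζ t * (f (evolution u₀ W t x) * φ x) - W (t, x) * φ x) := by
    refine integral_congr_ae ?_
    filter_upwards [h7] with x hx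
    rw [hx]; ring
  have i1 : Integrable (fun x => f (evolution u₀ W t x) * φ x) (volume.restrict Ω) :=
    hft.integrable_mul (hφ.memLp 2)
  have i2 : Integrable (fun x => W (t, x) * φ x) (volume.restrict Ω) :=
    hWt.integrable_mul (hφ.memLp 2)
  rw [e3, integral_sub (i1.const_mul _) i2, integral_const_mul, ← e1, ← e2, ← h9]
  ring

theorem hasDerivAt_primitive (hf : Continuous f) (y : ℝ) :
    HasDerivAt (primitive f) (f y) y :=
  (hf.integral_hasStrictDerivAt 0 y).hasDerivAt

theorem continuous_primitive (hf : Continuous f) : Continuous (primitive f) :=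
  continuous_iff_continuousAt.2 fun y => (hasDerivAt_primitive hf y).continuousAt

section Identities

variable {W H : ℝ × EuclideanSpace ℝ (Fin N) → ℝ} {M : ℝ}

theorem TimeRegular.ae_bound [IsFiniteMeasure (volume.restrict Ω)]
    (hr : TimeRegular Ω p ζ f u₀ T u G w W H M) :
    ∀ᵐ z ∂((volume.restrict (Ioo 0 T)).prod (volume.restrict Ω)),
      |evolution u₀ W z.1 z.2| ≤ M := by
  have h1 : ∀ᵐ z ∂((volume.restrict (Ioo 0 T)).prod (volume.restrict Ω)), z.1 ∈ Ioo 0 T :=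
    Measure.quasiMeasurePreserving_fst.ae (ae_restrict_mem measurableSet_Ioo)
  have h2 : ∀ᵐ z ∂((volume.restrict (Ioo 0 T)).prod (volume.restrict Ω)),
      ∀ t ∈ Icc 0 T, |evolution u₀ W t z.2| ≤ M := Measure.quasiMeasurePreserving_snd.ae hr.bound
  filter_upwards [h1, h2] with z hz1 hz2
  exact hz2 _ (Ioo_subset_Icc_self hz1)

theorem evolution_zero (u₀ : EuclideanSpace ℝ (Fin N) → ℝ)
    (W : ℝ × EuclideanSpace ℝ (Fin N) → ℝ) (x) : evolution u₀ W 0 x = u₀ x := by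
  simp [evolution]

/-- The energy inequality. -/
theorem IsWeakSolution.energy_le (hΩ : IsOpen Ω) [IsFiniteMeasure (volume.restrict Ω)]
    (hp : 2 < p) (hT : 0 < T) (hu₀ : MemLp u₀ ∞ (volume.restrict Ω)) (hu₀' : MemW0 Ω p u₀ G₀)
    (hζ : ContDiffOn ℝ 1 ζ (Ici 0)) (hζ' : ∀ t, 0 ≤ t → 0 ≤ derivWithin ζ (Ici 0) t)
    (hf : Continuous f) (hF : ∀ s, 0 ≤ primitive f s)
    (hs : IsWeakSolution Ω p ζ f u₀ T u G w) :
    ∀ᵐ t ∂(volume.restrict (Ioo 0 T)), energy Ω p (ζ t) f (u t) (G t) +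
      ∫ z, w z.1 z.2 ^ 2 ∂((volume.restrict (Ioo 0 t)).prod (volume.restrict Ω)) ≤
      energy Ω p (ζ 0) f u₀ G₀ := by
  obtain ⟨W, H, M, hr⟩ := hs.exists_timeRegular hΩ hT hu₀ hζ hf
  have hG := hs.grad_memLp
  rw [volume_restrict_cylinder] at hG
  have hΦ : IntegrableOn (fun t => 1 / p * ∫ x in Ω, ‖G t x‖ ^ p) (Ioo 0 T) :=
    (integrable_norm_rpow_of_memLp hp hG).integral_prod_left.const_mul _
  -- The set of good times is the predicate in `hr.slice`; convexity supplies both increment bounds.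
  have hkey := ae_sub_le_integral_of_increment_le (u₀ := u₀) (Φ₀ := 1 / p * ∫ x in Ω, ‖G₀ x‖ ^ p)
    hr.measurable_deriv hr.memLp_deriv
    hr.integrable_deriv hr.deriv_eq_zero hr.measurable_rhs hr.memLp_rhs hΦ hr.slice
    (by
      rintro r ⟨h1, -, h3, h4, -, h6⟩
      refine (dirichlet_sub_le hp h1 h3 h6 hu₀').trans (le_of_eq ?_)
      refine integral_congr_ae ?_
      filter_upwards [h4] with x hx
      rw [hx])
    (by
      rintro r ⟨h1, -, h3, h4, -, h6⟩ s ⟨k1, -, -, k4, -, -⟩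
      refine (dirichlet_sub_le hp h1 h3 h6 k1).trans (le_of_eq ?_)
      refine integral_congr_ae ?_
      filter_upwards [h4, k4] with x hx kx
      rw [hx, kx])
  filter_upwards [hkey, hr.slice, ae_restrict_mem measurableSet_Ioo] with b hb ⟨_, _, _, h4, _, _⟩ hbT
  have hle : (volume.restrict (Ioo 0 b)).prod (volume.restrict Ω) ≤
      (volume.restrict (Ioo 0 T)).prod (volume.restrict Ω) :=
    Measure.prod_mono (Measure.restrict_mono (Ioo_subset_Ioo_right hbT.2.le) le_rfl) le_rfl
  have hac := Measure.absolutelyContinuous_of_le hle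
  have hVm := aestronglyMeasurable_evolution hr.measurable_deriv hu₀.1 (volume.restrict (Ioo 0 b))
  have hVb := hac.ae_le hr.ae_bound
  have hfV := memLp_comp_of_bounded hf hVm hVb 2
  have hWb : MemLp W 2 ((volume.restrict (Ioo 0 b)).prod (volume.restrict Ω)) :=
    hr.memLp_deriv.mono_measure (Measure.prod_mono Measure.restrict_le_self le_rfl)
  have i1 : Integrable (fun z => ζ z.1 * (f (evolution u₀ W z.1 z.2) * W z))
      ((volume.restrict (Ioo 0 b)).prod (volume.restrict Ω)) := by
    have := (memLp_weight_mul hζ hfV).integrable_mul hWb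
    refine this.congr (Eventually.of_forall fun z => ?_)
    simp only [Pi.mul_apply, mul_assoc, Function.uncurry]
  have i2 := hWb.integrable_sq
  have hFb : Integrable (fun x => primitive f (evolution u₀ W b x)) (volume.restrict Ω) :=
    (memLp_comp_of_bounded (continuous_primitive hf)
      (aestronglyMeasurable_evolution_slice hr.measurable_deriv hu₀.1 b)
      (hr.bound.mono fun x hx => hx b (Ioo_subset_Icc_self hbT)) 1).integrable le_rfl
  have hF0 : Integrable (fun x => primitive f (u₀ x)) (volume.restrict Ω) := by
    refine (memLp_comp_of_bounded (M := M) (continuous_primitive hf) hu₀.1 ?_ 1).integrable le_rfl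
    filter_upwards [hr.bound] with x hx
    simpa [evolution_zero] using hx 0 (by simp [hT.le])
  -- In $\iint H u_t=\iint\zeta f(u)u_t-\iint u_t^2$ the first term is at most the increment of
  -- $\zeta\int F(u)$.
  have hch := integral_weight_comp_evolution_mul_le (hasDerivAt_primitive hf) hF hf
    hr.integrable_deriv hbT.1.le hζ hζ' i1 hFb hF0
  have e1 : ∫ z, H z * W z ∂((volume.restrict (Ioo 0 b)).prod (volume.restrict Ω)) =
      (∫ z, ζ z.1 * (f (evolution u₀ W z.1 z.2) * W z)
        ∂((volume.restrict (Ioo 0 b)).prod (volume.restrict Ω))) -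
      ∫ z, W z ^ 2 ∂((volume.restrict (Ioo 0 b)).prod (volume.restrict Ω)) := by
    rw [← integral_sub i1 i2]
    refine integral_congr_ae ?_
    filter_upwards [hac.ae_le hr.rhs_ae] with z hz
    rw [hz]; ring
  have e2 : ∫ z, w z.1 z.2 ^ 2 ∂((volume.restrict (Ioo 0 b)).prod (volume.restrict Ω)) =
      ∫ z, W z ^ 2 ∂((volume.restrict (Ioo 0 b)).prod (volume.restrict Ω)) := by
    refine integral_congr_ae ?_
    filter_upwards [hac.ae_le hr.deriv_ae] with z hz
    rw [← hz]; rfl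
  have e3 : ∫ x in Ω, primitive f (u b x) = ∫ x in Ω, primitive f (evolution u₀ W b x) := by
    refine integral_congr_ae ?_
    filter_upwards [h4] with x hx
    rw [hx]
  rw [e1] at hb
  rw [energy, energy, e2, e3]
  linarith

/-- The evolution of the `L^2` norm. -/
theorem IsWeakSolution.exists_sq_evolution (hΩ : IsOpen Ω) [IsFiniteMeasure (volume.restrict Ω)]
    (hp : 2 < p) (hT : 0 < T) (hu₀ : MemLp u₀ ∞ (volume.restrict Ω))
    (hζ : ContDiffOn ℝ 1 ζ (Ici 0)) (hf : Continuous f)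
    (hs : IsWeakSolution Ω p ζ f u₀ T u G w) :
    ∃ l : ℝ → ℝ, IntegrableOn l (Ioo 0 T) ∧ ∀ᵐ t ∂(volume.restrict (Ioo 0 T)),
      1 / 2 * (∫ x in Ω, u t x ^ 2) = 1 / 2 * (∫ x in Ω, u₀ x ^ 2) + ∫ s in (0 : ℝ)..t, l s ∧
      l t = ζ t * (∫ x in Ω, u t x * f (u t x)) - ∫ x in Ω, ‖G t x‖ ^ p := by
  obtain ⟨W, H, M, hr⟩ := hs.exists_timeRegular hΩ hT hu₀ hζ hf
  have hi {b : ℝ} (hb : b ≤ T) : Integrable (fun z => evolution u₀ W z.1 z.2 * W z)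
      ((volume.restrict (Ioo 0 b)).prod (volume.restrict Ω)) := by
    have hle : (volume.restrict (Ioo 0 b)).prod (volume.restrict Ω) ≤
        (volume.restrict (Ioo 0 T)).prod (volume.restrict Ω) :=
      Measure.prod_mono (Measure.restrict_mono (Ioo_subset_Ioo_right hb) le_rfl) le_rfl
    have hac := Measure.absolutelyContinuous_of_le hle
    have hVm := aestronglyMeasurable_evolution hr.measurable_deriv hu₀.1 (volume.restrict (Ioo 0 b))
    have hV := memLp_comp_of_bounded continuous_id hVm (hac.ae_le hr.ae_bound) 2
    have hWb : MemLp W 2 ((volume.restrict (Ioo 0 b)).prod (volume.restrict Ω)) :=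
      hr.memLp_deriv.mono_measure (Measure.prod_mono Measure.restrict_le_self le_rfl)
    exact hV.integrable_mul hWb
  -- The derivative of $\frac12\|u\|_2^2$ is $\int u\,u_t$; its second form comes from testing the
  -- equation with $u(t)$ itself.
  refine ⟨fun t => ∫ x in Ω, evolution u₀ W t x * W (t, x), (hi le_rfl).integral_prod_left, ?_⟩
  filter_upwards [hr.slice, ae_restrict_mem measurableSet_Ioo] with b ⟨h1, h2, h3, h4, h5, h6⟩ hbT
  have hVs : MemLp (evolution u₀ W b) 2 (volume.restrict Ω) :=
    memLp_comp_of_bounded continuous_id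
      (aestronglyMeasurable_evolution_slice hr.measurable_deriv hu₀.1 b)
      (hr.bound.mono fun x hx => hx b (Ioo_subset_Icc_self hbT)) 2
  have hfVs : MemLp (fun x => f (evolution u₀ W b x)) 2 (volume.restrict Ω) :=
    memLp_comp_of_bounded hf
      (aestronglyMeasurable_evolution_slice hr.measurable_deriv hu₀.1 b)
      (hr.bound.mono fun x hx => hx b (Ioo_subset_Icc_self hbT)) 2
  constructor
  · have hF (y : ℝ) : HasDerivAt (fun y : ℝ => 1 / 2 * y ^ 2) (id y) y := by
      have := (hasDerivAt_pow 2 y).const_mul (1 / 2 : ℝ)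
      refine this.congr_deriv ?_
      simp
    have h7 := integral_comp_evolution_mul hF continuous_id hr.integrable_deriv hbT.1.le
      (hi hbT.2.le) (hVs.integrable_sq.const_mul _)
      ((hu₀.mono_exponent (p := 2) le_top).integrable_sq.const_mul _)
    simp only [id] at h7
    rw [integral_prod _ (hi hbT.2.le), ← integral_Ioc_eq_integral_Ioo,
      ← intervalIntegral.integral_of_le hbT.1.le, integral_const_mul, integral_const_mul] at h7
    rw [h7]
    have e : ∫ x in Ω, u b x ^ 2 = ∫ x in Ω, evolution u₀ W b x ^ 2 := by
      refine integral_congr_ae ?_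
      filter_upwards [h4] with x hx
      rw [hx]
    rw [e]; ring
  · have h8 := integral_eq_of_memW0 hp h1.2.1 h3 h6 h1
    simp only [inner_flux_self hp] at h8
    have i1 : Integrable (fun x => evolution u₀ W b x * f (evolution u₀ W b x))
      (volume.restrict Ω) := hVs.integrable_mul hfVs
    have i2 : Integrable (fun x => evolution u₀ W b x * W (b, x)) (volume.restrict Ω) :=
      hVs.integrable_mul h2
    have e1 : ∫ x in Ω, H (b, x) * u b x =
        ∫ x in Ω, (ζ b * (evolution u₀ W b x * f (evolution u₀ W b x)) -
          evolution u₀ W b x * W (b, x)) := by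
      refine integral_congr_ae ?_
      filter_upwards [h4, h5] with x hx hx2
      rw [hx, hx2]; ring
    have e2 : ∫ x in Ω, u b x * f (u b x) =
        ∫ x in Ω, evolution u₀ W b x * f (evolution u₀ W b x) := by
      refine integral_congr_ae ?_
      filter_upwards [h4] with x hx
      rw [hx]
    rw [e1, integral_sub (i1.const_mul _) i2, integral_const_mul, ← e2] at h8
    rw [h8]; ring

end Identities

end

/-! ### Comparison for $L'\ge cL^q$ and the bound for the time of existence. -/

section

/-- Comparison principle: `L' ≥ c L^q` with `q > 1` bounds the time of existence. -/
theorem mul_le_of_superlinear_growth {L₀ c q T : ℝ} {l : ℝ → ℝ} (hL₀ : 0 < L₀) (hc : 0 ≤ c)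
    (hq : 1 < q) (hT : 0 < T) (hl : IntegrableOn l (Ioo 0 T))
    (h : ∀ᵐ t ∂(volume.restrict (Ioo 0 T)), 0 ≤ L₀ + ∫ s in (0 : ℝ)..t, l s ∧
      c * (L₀ + ∫ s in (0 : ℝ)..t, l s) ^ q ≤ l t) :
    c * T ≤ L₀ ^ (1 - q) / (q - 1) := by
  have hlI : IntervalIntegrable l volume 0 T := by
    rwa [intervalIntegrable_iff_integrableOn_Ioo_of_le hT.le]
  have hl0 : ∀ᵐ t, t ∈ Ioo 0 T → 0 ≤ l t := by
    rw [← ae_restrict_iff' measurableSet_Ioo]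
    filter_upwards [h] with t ht
    exact (mul_nonneg hc (Real.rpow_nonneg ht.1 q)).trans ht.2
  have hge {t : ℝ} (ht : t ∈ Icc 0 T) : L₀ ≤ L₀ + ∫ s in (0 : ℝ)..t, l s := by
    rw [le_add_iff_nonneg_right, intervalIntegral.integral_of_le ht.1, integral_Ioc_eq_integral_Ioo]
    refine setIntegral_nonneg_of_ae_restrict ?_
    rw [Filter.EventuallyLE, ae_restrict_iff' measurableSet_Ioo]
    filter_upwards [hl0] with s hs hst
    exact hs ⟨hst.1, hst.2.trans_le ht.2⟩
  -- The truncation at `L₀` makes $y^{-q}$ continuous on the whole line, as the chain rule requires;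
  -- nothing changes along the curve, which stays above `L₀`.
  set g : ℝ → ℝ := fun y => max y L₀ ^ (-q) with hg
  have hgc : Continuous g := by
    refine (continuous_id.max continuous_const).rpow_const fun y => Or.inl ?_
    exact (hL₀.trans_le (le_max_right _ _)).ne'
  have hF (y : ℝ) : HasDerivAt (fun y => ∫ s in L₀..y, g s) (g y) y :=
    (hgc.integral_hasStrictDerivAt L₀ y).hasDerivAt
  have hch := integral_comp_mul_eq_sub (c := L₀) hF hgc hlI
  rw [intervalIntegral.integral_same, sub_zero] at hch
  have hLT := hge (right_mem_Icc.2 hT.le)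
  have h1 : c * T ≤ ∫ t in (0 : ℝ)..T, g (L₀ + ∫ s in (0 : ℝ)..t, l s) * l t := by
    have e : c * T = ∫ _ in (0 : ℝ)..T, c := by simp [mul_comm]
    rw [e]
    have hcont : ContinuousOn (fun t => L₀ + ∫ s in (0 : ℝ)..t, l s) (uIcc 0 T) :=
      (absolutelyContinuousOnInterval_add_integral hlI).continuousOn
    have hi : IntervalIntegrable (fun t => g (L₀ + ∫ s in (0 : ℝ)..t, l s) * l t) volume 0 T :=
      hlI.continuousOn_mul (hgc.comp_continuousOn hcont)
    rw [intervalIntegral.integral_of_le hT.le, intervalIntegral.integral_of_le hT.le,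
      integral_Ioc_eq_integral_Ioo, integral_Ioc_eq_integral_Ioo]
    refine integral_mono_ae (by simp)
      ((intervalIntegrable_iff_integrableOn_Ioo_of_le hT.le).1 hi) ?_
    filter_upwards [h, ae_restrict_mem measurableSet_Ioo] with t ht htT
    have hL := hge (Ioo_subset_Icc_self htT)
    have hLp := hL₀.trans_le hL
    simp only [hg, max_eq_left hL]
    calc c = (L₀ + ∫ s in (0 : ℝ)..t, l s) ^ (-q) * (c * (L₀ + ∫ s in (0 : ℝ)..t, l s) ^ q) := by
          rw [mul_left_comm, ← Real.rpow_add hLp, neg_add_cancel, Real.rpow_zero, mul_one]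
      _ ≤ _ := mul_le_mul_of_nonneg_left ht.2 (Real.rpow_nonneg hLp.le _)
  have h2 : ∫ s in L₀..(L₀ + ∫ s in (0 : ℝ)..T, l s), g s =
      ∫ s in L₀..(L₀ + ∫ s in (0 : ℝ)..T, l s), s ^ (-q) := by
    refine intervalIntegral.integral_congr fun s hs => ?_
    rw [uIcc_of_le hLT] at hs
    simp only [hg, max_eq_left hs.1]
  have h0 : (0 : ℝ) ∉ uIcc L₀ (L₀ + ∫ s in (0 : ℝ)..T, l s) := by
    rw [uIcc_of_le hLT]
    exact fun h' => absurd h'.1 (not_le.2 hL₀)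
  rw [hch, h2, integral_rpow (Or.inr ⟨by linarith, h0⟩)] at h1
  refine h1.trans ?_
  -- The contribution of the endpoint $L(T)$ enters with a favourable sign and is dropped.
  have h3 : 0 ≤ (L₀ + ∫ s in (0 : ℝ)..T, l s) ^ (-q + 1) :=
    Real.rpow_nonneg (hL₀.le.trans hLT) _
  rw [show -q + 1 = 1 - q by ring] at h3 ⊢
  rw [← neg_div_neg_eq, neg_sub, neg_sub]
  exact div_le_div_of_nonneg_right (by linarith) (by linarith)

variable {N : ℕ} {Ω : Set (EuclideanSpace ℝ (Fin N))} {p κ : ℝ} {ζ f : ℝ → ℝ}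
  {u₀ : EuclideanSpace ℝ (Fin N) → ℝ}
  {G₀ : EuclideanSpace ℝ (Fin N) → EuclideanSpace ℝ (Fin N)} {T : ℝ}
  {u : ℝ → EuclideanSpace ℝ (Fin N) → ℝ}
  {G : ℝ → EuclideanSpace ℝ (Fin N) → EuclideanSpace ℝ (Fin N)}
  {w : ℝ → EuclideanSpace ℝ (Fin N) → ℝ}

theorem monotoneOn_of_derivWithin_Ici_nonneg (hζ : ContDiffOn ℝ 1 ζ (Ici 0))
    (hζ' : ∀ t, 0 ≤ t → 0 ≤ derivWithin ζ (Ici 0) t) : MonotoneOn ζ (Ici 0) := by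
  refine monotoneOn_of_deriv_nonneg (convex_Ici 0) hζ.continuousOn
    ((hζ.differentiableOn one_ne_zero).mono interior_subset) fun t ht => ?_
  rw [interior_Ici] at ht
  rw [← derivWithin_of_mem_nhds (Ici_mem_nhds ht)]
  exact hζ' t (le_of_lt ht)

theorem IsWeakSolution.ae_bound (hs : IsWeakSolution Ω p ζ f u₀ T u G w) :
    ∀ᵐ t ∂(volume.restrict (Ioo 0 T)), ∀ᵐ x ∂(volume.restrict Ω), |u t x| ≤
      (eLpNorm (Function.uncurry u) ∞ (volume.restrict (Ioo 0 T ×ˢ Ω))).toReal := by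
  have h1 := enorm_ae_le_eLpNormEssSup (Function.uncurry u) (volume.restrict (Ioo 0 T ×ˢ Ω))
  rw [← eLpNorm_exponent_top] at h1
  have h2 : ∀ᵐ z ∂(volume.restrict (Ioo 0 T ×ˢ Ω)), |u z.1 z.2| ≤
      (eLpNorm (Function.uncurry u) ∞ (volume.restrict (Ioo 0 T ×ˢ Ω))).toReal := by
    filter_upwards [h1] with z hz
    have h3 := ENNReal.toReal_mono hs.bounded.2.ne hz
    rw [toReal_enorm] at h3
    exact h3
  rw [volume_restrict_cylinder] at h2 ⊢
  exact Measure.ae_ae_of_ae_prod h2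

/-- The explicit bound for the time of existence. -/
theorem IsWeakSolution.le_blowUpBound (hΩ : IsOpen Ω) [IsFiniteMeasure (volume.restrict Ω)]
    (hp : 2 < p) (hκ : p < κ) (hT : 0 < T) (hu₀ : MemLp u₀ ∞ (volume.restrict Ω))
    (hu₀' : MemW0 Ω p u₀ G₀) (hu₀_ne : ¬ u₀ =ᵐ[volume.restrict Ω] 0)
    (hE : energy Ω p (ζ 0) f u₀ G₀ ≤ 0)
    (hζ : ContDiffOn ℝ 1 ζ (Ici 0)) (hζ0 : 0 < ζ 0)
    (hζ' : ∀ t, 0 ≤ t → 0 ≤ derivWithin ζ (Ici 0) t) (hf : Continuous f)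
    (hF : ∀ s, 0 ≤ κ * primitive f s ∧ κ * primitive f s ≤ s * f s)
    (hs : IsWeakSolution Ω p ζ f u₀ T u G w) {C : ℝ} (hC : PoincareConst Ω p C) :
    T ≤ blowUpBound Ω p κ C u₀ := by
  have hp0 : 0 < p := by linarith
  have hκ0 : 0 < κ := by linarith
  obtain ⟨hC0, hC⟩ := hC
  have hF0 (s : ℝ) : 0 ≤ primitive f s := nonneg_of_mul_nonneg_right (hF s).1 hκ0
  obtain ⟨l, hl, hL⟩ := hs.exists_sq_evolution hΩ hp hT hu₀ hζ hf
  have hen := hs.energy_le hΩ hp hT hu₀ hu₀' hζ hζ' hf hF0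
  set L₀ := 1 / 2 * ∫ x in Ω, u₀ x ^ 2 with hL₀def
  have hL₀ : 0 < L₀ := by
    have h0 : 0 ≤ ∫ x in Ω, u₀ x ^ 2 := by positivity
    refine mul_pos (by norm_num) (lt_of_le_of_ne h0 fun h => hu₀_ne ?_)
    have h2 := (integral_eq_zero_iff_of_nonneg (fun x => sq_nonneg (u₀ x))
      (hu₀.mono_exponent (p := 2) le_top).integrable_sq).1 h.symm
    filter_upwards [h2] with x hx
    simpa using hx
  have hmono := monotoneOn_of_derivWithin_Ici_nonneg hζ hζ'
  -- The factor $(\kappa-p)/p$ is what remains of $\kappa\cdot\frac1p-1$ after the energy bound, and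
  -- $C^{-p/2}$ comes from the Poincaré inequality raised to the power $p/2$.
  have key := mul_le_of_superlinear_growth (c := (κ - p) / p * (C ^ (p / 2))⁻¹) (q := p / 2) hL₀
    (mul_nonneg (div_nonneg (by linarith) hp0.le) (by positivity)) (by linarith) hT hl ?_
  · have hCp : 0 < C ^ (p / 2) := by positivity
    rw [blowUpBound, ← hL₀def, le_div_iff₀ (mul_pos (by linarith) (by linarith))]
    rw [le_div_iff₀ (by linarith)] at key
    have h4 := mul_le_mul_of_nonneg_left key (show 0 ≤ 2 * p * C ^ (p / 2) by positivity)
    have h5 : 2 * p * C ^ (p / 2) * ((κ - p) / p * (C ^ (p / 2))⁻¹ * T * (p / 2 - 1)) =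
        T * ((p - 2) * (κ - p)) := by
      field_simp
    rwa [h5] at h4
  · filter_upwards [hL, hen, hs.memW0, hs.ae_bound, ae_restrict_mem measurableSet_Ioo] with
      t ⟨h1, h2⟩ h3 h4 h5 htT
    rw [← h1, h2]
    have hI0 : 0 ≤ ∫ x in Ω, ‖G t x‖ ^ p := by positivity
    have hs0 : 0 ≤ ∫ x in Ω, u t x ^ 2 := by positivity
    refine ⟨by positivity, ?_⟩
    have hw0 : 0 ≤ ∫ z, w z.1 z.2 ^ 2
      ∂((volume.restrict (Ioo 0 t)).prod (volume.restrict Ω)) := by positivity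
    have hE' : energy Ω p (ζ t) f (u t) (G t) ≤ 0 := by linarith
    rw [energy] at hE'
    have i1 : Integrable (fun x => primitive f (u t x)) (volume.restrict Ω) :=
      (memLp_comp_of_bounded (continuous_primitive hf) h4.1.1 h5 1).integrable le_rfl
    have i2 : Integrable (fun x => u t x * f (u t x)) (volume.restrict Ω) :=
      (memLp_comp_of_bounded (g := fun y => y * f y) (continuous_id.mul hf) h4.1.1 h5 1).integrable
        le_rfl
    have h6 : κ * ∫ x in Ω, primitive f (u t x) ≤ ∫ x in Ω, u t x * f (u t x) := by
      rw [← integral_const_mul]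
      exact integral_mono (i1.const_mul _) i2 fun x => (hF (u t x)).2
    have hζt : 0 ≤ ζ t := hζ0.le.trans (hmono self_mem_Ici htT.1.le htT.1.le)
    have h7 := mul_le_mul_of_nonneg_left h6 hζt
    have h8 := hC _ _ h4
    have h9 : (1 / 2 * ∫ x in Ω, u t x ^ 2) ^ (p / 2) ≤ C ^ (p / 2) * ∫ x in Ω, ‖G t x‖ ^ p := by
      refine (Real.rpow_le_rpow (by positivity) h8 (by positivity)).trans ?_
      rw [Real.mul_rpow hC0.le (by positivity), ← Real.rpow_mul hI0,
        show 2 / p * (p / 2) = 1 by field_simp, Real.rpow_one]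
    have h10 : (κ - p) / p * (C ^ (p / 2))⁻¹ * (1 / 2 * ∫ x in Ω, u t x ^ 2) ^ (p / 2) ≤
        (κ - p) / p * ∫ x in Ω, ‖G t x‖ ^ p := by
      rw [mul_assoc]
      refine mul_le_mul_of_nonneg_left ?_ (div_nonneg (by linarith) hp0.le)
      rw [inv_mul_le_iff₀ (by positivity)]
      exact h9
    refine h10.trans ?_
    have h11 : (κ - p) / p * (∫ x in Ω, ‖G t x‖ ^ p) =
        κ * (1 / p * ∫ x in Ω, ‖G t x‖ ^ p) - ∫ x in Ω, ‖G t x‖ ^ p := by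
      field_simp
    -- Here the nonpositive energy enters; `h7` then replaces $\kappa F(u)$ by $uf(u)$.
    have h12 : κ * (1 / p * ∫ x in Ω, ‖G t x‖ ^ p) ≤ κ * (ζ t * ∫ x in Ω, primitive f (u t x)) :=
      mul_le_mul_of_nonneg_left (by linarith) hκ0.le
    rw [h11]
    linarith

/-! ### Continuation of bounded solutions up to the final time. -/

section Continuation

/-- A sequence increasing to `T`. -/
def approachTime (T : ℝ) (n : ℕ) : ℝ := T - T / (n + 2)

theorem approachTime_pos (hT : 0 < T) (n : ℕ) : 0 < approachTime T n := by
  rw [approachTime, sub_pos]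
  -- The shift by $2$ in the denominator makes the term $n=0$ equal to $T/2$ instead of $0$.
  refine div_lt_self hT ?_
  have : (0 : ℝ) ≤ n := n.cast_nonneg
  linarith

theorem approachTime_lt (hT : 0 < T) (n : ℕ) : approachTime T n < T := by
  rw [approachTime, sub_lt_self_iff]
  positivity

theorem tendsto_approachTime (T : ℝ) : Tendsto (approachTime T) atTop (𝓝 T) := by
  have h1 : Tendsto (fun n : ℕ => T / ((n : ℝ) + 2)) atTop (𝓝 0) :=
    tendsto_const_nhds.div_atTop (tendsto_natCast_atTop_atTop.atTop_add tendsto_const_nhds)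
  have h2 := (tendsto_const_nhds (x := T)).sub h1
  rw [sub_zero] at h2
  exact h2

theorem iUnion_Ioo_approachTime (hT : 0 < T) : ⋃ n, Ioo 0 (approachTime T n) = Ioo 0 T := by
  ext t
  simp only [mem_iUnion, mem_Ioo]
  constructor
  · rintro ⟨n, h1, h2⟩
    exact ⟨h1, h2.trans (approachTime_lt hT n)⟩
  · rintro ⟨h1, h2⟩
    obtain ⟨n, hn⟩ := ((tendsto_approachTime T).eventually (lt_mem_nhds h2)).exists
    exact ⟨n, h1, hn⟩

theorem iUnion_cylinder_approachTime (hT : 0 < T) (Ω : Set (EuclideanSpace ℝ (Fin N))) :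
    ⋃ n, Ioo 0 (approachTime T n) ×ˢ Ω = Ioo 0 T ×ˢ Ω := by
  rw [← iUnion_prod_const, iUnion_Ioo_approachTime hT]

theorem aecover_cylinder_approachTime (hΩ : IsOpen Ω) :
    AECover (volume.restrict (Ioo 0 T ×ˢ Ω)) atTop
      fun n => Ioo 0 (approachTime T n) ×ˢ Ω := by
  refine ⟨?_, fun n => measurableSet_Ioo.prod hΩ.measurableSet⟩
  filter_upwards [ae_restrict_mem (measurableSet_Ioo.prod hΩ.measurableSet)] with z hz
  filter_upwards [(tendsto_approachTime T).eventually (lt_mem_nhds hz.1.2)] with n hn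
  exact ⟨⟨hz.1.1, hn⟩, hz.2⟩

/-- Boundedness of the integrals over all shorter cylinders gives integrability. -/
theorem integrable_cylinder_of_bounded (hT : 0 < T) (hΩ : IsOpen Ω)
    {g : ℝ × EuclideanSpace ℝ (Fin N) → ℝ} (hg : ∀ z, 0 ≤ g z) {K : ℝ}
    (hi : ∀ S, 0 < S → S < T → IntegrableOn g (Ioo 0 S ×ˢ Ω))
    (hK : ∀ S, 0 < S → S < T → ∃ R, S ≤ R ∧ R < T ∧ ∫ z in Ioo 0 R ×ˢ Ω, g z ≤ K) :
    IntegrableOn g (Ioo 0 T ×ˢ Ω) := by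
  have hrr (n : ℕ) : (volume.restrict (Ioo 0 T ×ˢ Ω)).restrict (Ioo 0 (approachTime T n) ×ˢ Ω) =
      volume.restrict (Ioo 0 (approachTime T n) ×ˢ Ω) := by
    refine Measure.restrict_restrict_of_subset (prod_mono_left (Ioo_subset_Ioo_right ?_))
    exact (approachTime_lt hT n).le
  refine (aecover_cylinder_approachTime hΩ).integrable_of_integral_norm_bounded K ?_ ?_
  · intro n
    rw [IntegrableOn, hrr]
    exact hi _ (approachTime_pos hT n) (approachTime_lt hT n)
  · refine Eventually.of_forall fun n => ?_
    rw [hrr]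
    -- The estimates hold only at almost every time, so the bound is taken at some later $R$ and
    -- transferred by monotonicity.
    obtain ⟨R, h1, h2, h3⟩ := hK _ (approachTime_pos hT n) (approachTime_lt hT n)
    refine le_trans ?_ h3
    simp only [Real.norm_of_nonneg (hg _)]
    exact setIntegral_mono_set (hi R ((approachTime_pos hT n).trans_le h1) h2)
      (Eventually.of_forall hg) (LE.le.eventuallyLE
        (prod_mono_left (Ioo_subset_Ioo_right h1)))

/-- By compactness the support ends strictly before $T$, so the weak formulation on a shorter
interval already covers each test function. -/
theorem IsTestFunction.exists_time_lt {φ : ℝ × EuclideanSpace ℝ (Fin N) → ℝ} (hT : 0 < T)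
    (hφ : IsTestFunction (Iio T ×ˢ Ω) φ) :
    ∃ S, 0 < S ∧ S < T ∧ ∀ z ∈ tsupport φ, z.1 < S := by
  rcases (tsupport φ).eq_empty_or_nonempty with h | h
  · exact ⟨T / 2, by linarith, by linarith, by simp [h]⟩
  · obtain ⟨z, hz, hmax⟩ := hφ.2.1.isCompact.exists_isMaxOn h continuous_fst.continuousOn
    have hzT : z.1 < T := (hφ.2.2 hz).1
    obtain ⟨S, hS1, hS2⟩ := exists_between (max_lt hT hzT)
    exact ⟨S, (le_max_left _ _).trans_lt hS1, hS2, fun y hy =>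
      (hmax hy).trans_lt ((le_max_right _ _).trans_lt hS1)⟩

/-- A solution that stays bounded up to time `T` is a solution on `(0,T)`. -/
theorem isWeakSolution_of_bounded (hΩ : IsOpen Ω) [IsFiniteMeasure (volume.restrict Ω)]
    (hp : 2 < p) (hT : 0 < T) (hu₀ : MemLp u₀ ∞ (volume.restrict Ω))
    (hu₀' : MemW0 Ω p u₀ G₀) (hζ : ContDiffOn ℝ 1 ζ (Ici 0)) (hζ0 : 0 < ζ 0)
    (hζ' : ∀ t, 0 ≤ t → 0 ≤ derivWithin ζ (Ici 0) t) (hf : Continuous f)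
    (hF : ∀ s, 0 ≤ primitive f s)
    (hs : ∀ S, 0 < S → S < T → IsWeakSolution Ω p ζ f u₀ S u G w) {M : NNReal}
    (hM : ∀ S, S < T → eLpNorm (Function.uncurry u) ∞ (volume.restrict (Ioo 0 S ×ˢ Ω)) ≤ M) :
    IsWeakSolution Ω p ζ f u₀ T u G w := by
  have hp0 : 0 < p := by linarith
  have hmono := monotoneOn_of_derivWithin_Ici_nonneg hζ hζ'
  have hsn (n : ℕ) := hs _ (approachTime_pos hT n) (approachTime_lt hT n)
  have hU := iUnion_cylinder_approachTime hT Ω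
  have hUt := iUnion_Ioo_approachTime hT
  have hbd {S : ℝ} (hS0 : 0 < S) (hS : S < T) : ∀ᵐ t ∂(volume.restrict (Ioo 0 S)),
      ∀ᵐ x ∂(volume.restrict Ω), |u t x| ≤ M := by
    filter_upwards [(hs S hS0 hS).ae_bound] with t ht
    filter_upwards [ht] with x hx
    exact hx.trans (by simpa using ENNReal.toReal_mono ENNReal.coe_ne_top (hM S hS))
  have hζnn {t : ℝ} (h0 : 0 < t) : 0 ≤ ζ t := hζ0.le.trans (hmono self_mem_Ici h0.le h0.le)
  have hζle {t : ℝ} (h0 : 0 < t) (h1 : t < T) : ζ t ≤ ζ T := hmono h0.le hT.le h1.le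
  have hpick {S : ℝ} (hS0 : 0 < S) (hS : S < T) {P : ℝ → Prop}
      (hP : ∀ R, S < R → R < T → ∀ᵐ t ∂(volume.restrict (Ioo 0 R)), P t) :
      ∃ t, S ≤ t ∧ t < T ∧ P t := by
    obtain ⟨R, hR1, hR2⟩ := exists_between hS
    have h1 := hP R hR1 hR2
    have h2 : ∀ᵐ t ∂(volume.restrict (Ioo S R)), P t :=
      ae_mono (Measure.restrict_mono (Ioo_subset_Ioo_left hS0.le) le_rfl) h1
    have hne : NeBot (ae (volume.restrict (Ioo S R))) := by
      rw [ae_neBot, Ne, Measure.restrict_eq_zero, Real.volume_Ioo, ENNReal.ofReal_eq_zero, not_le]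
      linarith
    obtain ⟨t, ht1, ht2⟩ := (h2.and (ae_restrict_mem measurableSet_Ioo)).exists
    exact ⟨t, ht2.1.le, ht2.2.trans hR2, ht1⟩
  have hGm : AEStronglyMeasurable (Function.uncurry G) (volume.restrict (Ioo 0 T ×ˢ Ω)) := by
    rw [← hU, aestronglyMeasurable_iUnion_iff]
    exact fun n => (hsn n).grad_memLp.1
  have hwm : AEStronglyMeasurable (Function.uncurry w) (volume.restrict (Ioo 0 T ×ˢ Ω)) := by
    rw [← hU, aestronglyMeasurable_iUnion_iff]
    exact fun n => (hsn n).deriv_memLp.1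
  have hGi {S : ℝ} (h0 : 0 < S) (h1 : S < T) :
      IntegrableOn (fun z : ℝ × EuclideanSpace ℝ (Fin N) => ‖G z.1 z.2‖ ^ p) (Ioo 0 S ×ˢ Ω) :=
    integrable_norm_rpow_of_memLp hp (hs S h0 h1).grad_memLp
  refine ⟨?_, ?_, ?_, ?_, ?_, ?_⟩
  · refine memLp_top_of_bound ?_ M ?_
    · rw [← hU, aestronglyMeasurable_iUnion_iff]
      exact fun n => (hsn n).bounded.1
    · rw [← hU, ae_restrict_iUnion_iff]
      intro n
      have h1 := enorm_ae_le_eLpNormEssSup (Function.uncurry u)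
        (volume.restrict (Ioo 0 (approachTime T n) ×ˢ Ω))
      rw [← eLpNorm_exponent_top] at h1
      filter_upwards [h1] with z hz
      have h3 := ENNReal.toReal_mono ENNReal.coe_ne_top (hz.trans (hM _ (approachTime_lt hT n)))
      rwa [toReal_enorm] at h3
  -- Gradient bound: in the integrated $L^2$ identity $\frac12\|u(t)\|_2^2\ge0$ is dropped, leaving
  -- $\iint|\nabla u|^p\le\iint\zeta uf(u)+\frac12\|u_0\|_2^2$, where $|uf(u)|\le B$ and
  -- $\zeta\le\zeta(T)$.
  · obtain ⟨B, hB0, hB⟩ := exists_bound_comp_of_continuous (g := fun y => y * f y)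
      (continuous_id.mul hf) M
    rw [← integrable_norm_rpow_iff hGm (by simpa using hp0) (by simp),
      ENNReal.toReal_ofReal hp0.le]
    refine integrable_cylinder_of_bounded hT hΩ (fun z => by positivity)
      (K := ζ T * (B * (volume.restrict Ω).real univ) * T + 1 / 2 * ∫ x in Ω, u₀ x ^ 2)
      (fun S h0 h1 => hGi h0 h1) fun S hS0 hS => ?_
    refine hpick hS0 hS fun R hR1 hR2 => ?_
    have hR0 := hS0.trans hR1
    obtain ⟨l, hl, hL⟩ := (hs R hR0 hR2).exists_sq_evolution hΩ hp hR0 hu₀ hζ hf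
    filter_upwards [hL, ae_restrict_mem measurableSet_Ioo] with t ⟨ht, _⟩ htR
    have htT := htR.2.trans hR2
    have hi := hGi htR.1 htT
    have hle : Ioo 0 t ⊆ Ioo 0 R := Ioo_subset_Ioo_right htR.2.le
    rw [IntegrableOn, volume_restrict_cylinder] at hi
    simp only [Function.uncurry]
    rw [volume_restrict_cylinder, integral_prod _ hi]
    have h1 : ∫ s in (0 : ℝ)..t, l s ≤ ∫ s in Ioo 0 t,
        (ζ T * (B * (volume.restrict Ω).real univ) - ∫ x in Ω, ‖G s x‖ ^ p) := by
      rw [intervalIntegral.integral_of_le htR.1.le, integral_Ioc_eq_integral_Ioo]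
      refine integral_mono_ae (hl.mono_set hle) ((integrable_const _).sub hi.integral_prod_left) ?_
      filter_upwards [ae_mono (Measure.restrict_mono hle le_rfl) hL,
        ae_mono (Measure.restrict_mono hle le_rfl) (hbd hR0 hR2),
        ae_restrict_mem measurableSet_Ioo] with s ⟨_, h2⟩ h3 h4
      rw [h2]
      refine sub_le_sub_right ?_ _
      have h5 : ‖∫ x in Ω, u s x * f (u s x)‖ ≤ B * (volume.restrict Ω).real univ :=
        norm_integral_le_of_norm_le_const (h3.mono fun x hx => hB _ hx)
      refine (mul_le_mul_of_nonneg_left ((le_abs_self _).trans h5) (hζnn h4.1)).trans ?_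
      exact mul_le_mul_of_nonneg_right (hζle h4.1 (h4.2.trans htT)) (by positivity)
    rw [integral_sub (integrable_const _) hi.integral_prod_left] at h1
    have h2 : ∫ _ in Ioo 0 t, ζ T * (B * (volume.restrict Ω).real univ) =
        ζ T * (B * (volume.restrict Ω).real univ) * t := by
      simp [htR.1.le]
      ring
    rw [h2] at h1
    have h3 : 0 ≤ 1 / 2 * ∫ x in Ω, u t x ^ 2 := by positivity
    have h4 : ζ T * (B * (volume.restrict Ω).real univ) * t ≤
        ζ T * (B * (volume.restrict Ω).real univ) * T :=
      mul_le_mul_of_nonneg_left htT.le (mul_nonneg (hζnn hT) (by positivity))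
    linarith
  · rw [← hUt, ae_restrict_iUnion_iff]
    exact fun n => (hsn n).memW0
  -- Bound for $u_t$: the energy inequality without its Dirichlet term, with $F(u)$ bounded on the
  -- range of $u$.
  · obtain ⟨B, hB0, hB⟩ := exists_bound_comp_of_continuous (continuous_primitive hf) M
    rw [memLp_two_iff_integrable_sq hwm]
    refine integrable_cylinder_of_bounded hT hΩ (fun z => sq_nonneg _)
      (K := energy Ω p (ζ 0) f u₀ G₀ + ζ T * (B * (volume.restrict Ω).real univ))
      (fun S h0 h1 => (hs S h0 h1).deriv_memLp.integrable_sq) fun S hS0 hS => ?_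
    refine hpick hS0 hS fun R hR1 hR2 => ?_
    have hR0 := hS0.trans hR1
    filter_upwards [(hs R hR0 hR2).energy_le hΩ hp hR0 hu₀ hu₀' hζ hζ' hf hF, hbd hR0 hR2,
      ae_restrict_mem measurableSet_Ioo] with t h1 h3 htR
    have htT := htR.2.trans hR2
    have h5 : ‖∫ x in Ω, primitive f (u t x)‖ ≤ B * (volume.restrict Ω).real univ :=
      norm_integral_le_of_norm_le_const (h3.mono fun x hx => hB _ hx)
    have h6 : ζ t * (∫ x in Ω, primitive f (u t x)) ≤ ζ T * (B * (volume.restrict Ω).real univ) :=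
      (mul_le_mul_of_nonneg_left ((le_abs_self _).trans h5) (hζnn htR.1)).trans
        (mul_le_mul_of_nonneg_right (hζle htR.1 htT) (by positivity))
    have h7 : 0 ≤ 1 / p * ∫ x in Ω, ‖G t x‖ ^ p := by positivity
    rw [volume_restrict_cylinder]
    simp only [Function.uncurry]
    rw [energy] at h1
    linarith
  · intro φ hφ
    obtain ⟨S, hS0, hST, hS⟩ := hφ.exists_time_lt hT
    have hφS : IsTestFunction (Iio S ×ˢ Ω) φ :=
      ⟨hφ.1, hφ.2.1, fun z hz => ⟨hS z hz, (hφ.2.2 hz).2⟩⟩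
    have h1 := (hs S hS0 hST).deriv_initial φ hφS
    have hz0 {z : ℝ × EuclideanSpace ℝ (Fin N)} (hz : S ≤ z.1) : φ z = 0 :=
      image_eq_zero_of_notMem_tsupport fun h => absurd (hS z h) (not_lt.2 hz)
    have hd0 {z : ℝ × EuclideanSpace ℝ (Fin N)} (hz : S ≤ z.1) :
        deriv (fun s => φ (s, z.2)) z.1 = 0 := by
      have hev : ∀ᶠ y in 𝓝 z, φ y = 0 := by
        have : z ∉ tsupport φ := fun h => absurd (hS z h) (not_lt.2 hz)
        exact notMem_tsupport_iff_eventuallyEq.1 this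
      have hev2 : ∀ᶠ s in 𝓝 z.1, φ (s, z.2) = 0 :=
        (Continuous.tendsto (by fun_prop : Continuous fun s : ℝ => (s, z.2)) z.1).eventually hev
      rw [(show (fun s => φ (s, z.2)) =ᶠ[𝓝 z.1] fun _ => 0 from hev2).deriv_eq, deriv_const]
    have hsub : Ioo 0 S ×ˢ Ω ⊆ Ioo 0 T ×ˢ Ω := prod_mono_left (Ioo_subset_Ioo_right hST.le)
    have hout {z : ℝ × EuclideanSpace ℝ (Fin N)} (hz : z ∈ (Ioo 0 T ×ˢ Ω) \ (Ioo 0 S ×ˢ Ω)) :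
        S ≤ z.1 := by
      by_contra h
      exact hz.2 ⟨⟨hz.1.1.1, not_le.1 h⟩, hz.1.2⟩
    rw [setIntegral_eq_of_subset_of_forall_sdiff_eq_zero
      (measurableSet_Ioo.prod hΩ.measurableSet) hsub
      (fun z hz => by rw [hd0 (hout hz), mul_zero]),
      setIntegral_eq_of_subset_of_forall_sdiff_eq_zero
      (measurableSet_Ioo.prod hΩ.measurableSet) hsub
      (fun z hz => by rw [hz0 (hout hz), mul_zero])]
    exact h1
  · rw [← hUt, ae_restrict_iUnion_iff]
    exact fun n => (hsn n).equation

end Continuation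

end

end PLaplaceHeat

end

/-! ### The blow-up theorem. -/

theorem theorem4 {N : ℕ} (hN : 1 ≤ N) (Ω : Set (EuclideanSpace ℝ (Fin N)))
    (hΩ_open : IsOpen Ω) (hΩ_bdd : Bornology.IsBounded Ω)
    (p κ : ℝ) (hp : 2 < p) (hκ : p < κ)
    (ζ : ℝ → ℝ) (hζ : ContDiffOn ℝ 1 ζ (Ici 0)) (hζ0 : 0 < ζ 0)
    (hζ' : ∀ t, 0 ≤ t → 0 ≤ derivWithin ζ (Ici 0) t)
    (f : ℝ → ℝ) (hf : Continuous f) (hfg : ∃ g : ℝ → ℝ, ContDiff ℝ 1 g ∧ ∀ s, |f s| ≤ g s)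
    (hF : ∀ s, 0 ≤ κ * PLaplaceHeat.primitive f s ∧ κ * PLaplaceHeat.primitive f s ≤ s * f s)
    (u₀ : EuclideanSpace ℝ (Fin N) → ℝ)
    (G₀ : EuclideanSpace ℝ (Fin N) → EuclideanSpace ℝ (Fin N))
    (hu₀_bdd : MemLp u₀ ∞ (volume.restrict Ω))
    (hu₀_W0 : PLaplaceHeat.MemW0 Ω p u₀ G₀)
    (hu₀_ne : ¬ u₀ =ᵐ[volume.restrict Ω] 0)
    (hu₀_energy : PLaplaceHeat.energy Ω p (ζ 0) f u₀ G₀ ≤ 0) :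
    -- the bound is available: admissible constants, depending only on `Ω` and `p`, exist
    (∃ C : ℝ, PLaplaceHeat.PoincareConst Ω p C) ∧
    ∀ (u : ℝ → EuclideanSpace ℝ (Fin N) → ℝ)
      (G : ℝ → EuclideanSpace ℝ (Fin N) → EuclideanSpace ℝ (Fin N))
      (w : ℝ → EuclideanSpace ℝ (Fin N) → ℝ) (T : ℝ), 0 < T →
      -- finite maximal time of existence, with the explicit bound
      (PLaplaceHeat.IsWeakSolution Ω p ζ f u₀ T u G w →
        ∀ C : ℝ, PLaplaceHeat.PoincareConst Ω p C → T ≤ PLaplaceHeat.blowUpBound Ω p κ C u₀) ∧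
      -- the sup norm becomes infinite at the time when `u` ceases to be a solution
      ((∀ T', 0 < T' → T' < T → PLaplaceHeat.IsWeakSolution Ω p ζ f u₀ T' u G w) →
        ¬ PLaplaceHeat.IsWeakSolution Ω p ζ f u₀ T u G w →
        Tendsto (fun t => eLpNorm (Function.uncurry u) ∞ (volume.restrict (Ioo 0 t ×ˢ Ω)))
          (𝓝[<] T) (𝓝 ∞)) := by
  have : IsFiniteMeasure (volume.restrict Ω) := ⟨by simpa using hΩ_bdd.measure_lt_top⟩
  refine ⟨PLaplaceHeat.exists_poincareConst hN hΩ_bdd hp, fun u G w T hT => ⟨fun hs C hC => ?_,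
    fun hs hns => ?_⟩⟩
  · exact hs.le_blowUpBound hΩ_open hp hκ hT hu₀_bdd hu₀_W0 hu₀_ne hu₀_energy hζ hζ0 hζ' hf hF hC
  · rw [ENNReal.tendsto_nhds_top_iff_nnreal]
    intro M
    by_contra hcon
    refine hns (PLaplaceHeat.isWeakSolution_of_bounded hΩ_open hp hT hu₀_bdd hu₀_W0 hζ hζ0 hζ' hf
      (fun s => nonneg_of_mul_nonneg_right (hF s).1 (by linarith)) hs (M := M) fun S hS => ?_)
    -- The sup norm over $(0,t)$ is nondecreasing in $t$: exceeding $M$ at one time $S<T$ means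
    -- exceeding it at all later times, against `hcon`.
    by_contra hlt
    refine hcon ?_
    filter_upwards [Ioo_mem_nhdsLT hS] with t ht
    refine (not_le.1 hlt).trans_le (eLpNorm_mono_measure _ (Measure.restrict_mono ?_ le_rfl))
    exact prod_mono_left (Ioo_subset_Ioo_right ht.1.le)
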